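/- Let $k$ be an algebraically closed field of characteristic $2$. For an integer $r\ge 1$ let $B_r=kQ/I$, where $Q$ is the quiver with vertices $1,2,3$ and arrows $$c_1:1\to2,\quad c_2:2\to3,\quad c_3:3\to1,\quad d_1:2\to1,\quad d_2:3\to2,\quad d_3:1\to3,$$ and $I$ is the ideal generated by the relations (paths are composed from left to right) $$c_1c_2=c_2c_3=c_3c_1=0,\qquad d_1d_3=d_3d_2=d_2d_1=0,$$ $$c_1d_1=d_3c_3,\qquad d_1c_1=(c_2d_2)^r,\qquad c_3d_3=(d_2c_2)^r.$$ A $k$-algebra $A$ is called tightly graded if there is an isomorphism of $k$-algebras $A\cong \mathrm{gr}_{\mathrm{rad}\,A}(A)=\bigoplus_{i\ge0}\mathrm{rad}^iA/\mathrm{rad}^{i+1}A$. A grading $A=\bigoplus_{i\ge0}A_i$ is called tight if $A_0$ is semisimple and $A$ is generated, as an algebra, by $A_0$ and $A_1$. Then, for every integer $r\ge1$, the algebra $B_r$ is tightly graded if and only if $r=1$; and $B_r$ has a tight grading if and only if $r=1$. -/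

import Mathlib

/-! ## Path algebras -/

section PathAlgebra

universe u v w

/-- The paths of a quiver `Q`, each with its source and its target. A vertex `a` is regarded as the
path `⟨a, a, Quiver.Path.nil⟩` of length zero. -/
abbrev QuiverPath (Q : Type v) [Quiver.{w} Q] : Type (max v w) :=
  Σ a : Q, Σ b : Q, Quiver.Path a b

/-- The path algebra `kQ`: the vector space with basis the paths of `Q`. Paths are composed from
left to right, i.e. `p * q` is "first `p`, then `q`" if the target of `p` is the source of `q`, and
it is zero otherwise. -/
def PathAlgebra (k : Type u) (Q : Type v) [Field k] [Quiver.{w} Q] : Type (max u v w) :=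
  QuiverPath Q →₀ k

namespace PathAlgebra

variable (k : Type u) {Q : Type v} [Field k] [Quiver.{w} Q]

noncomputable instance : AddCommGroup (PathAlgebra k Q) :=
  inferInstanceAs (AddCommGroup (QuiverPath Q →₀ k))

noncomputable instance : Module k (PathAlgebra k Q) :=
  inferInstanceAs (Module k (QuiverPath Q →₀ k))

/-- The basis element of `kQ` given by a path. -/
noncomputable def ofPath {a b : Q} (p : Quiver.Path a b) : PathAlgebra k Q :=
  (Finsupp.single ⟨a, b, p⟩ 1 : QuiverPath Q →₀ k)

/-- The basis of `kQ` that consists of all paths. -/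
noncomputable def pathBasis (Q : Type v) [Quiver.{w} Q] :
    Module.Basis (QuiverPath Q) k (PathAlgebra k Q) :=
  Module.Basis.ofRepr (LinearEquiv.refl k (QuiverPath Q →₀ k))

theorem pathBasis_apply (p : QuiverPath Q) : pathBasis k Q p = ofPath k p.2.2 := rfl

open Classical in
/-- The product of two paths in `kQ`. -/
noncomputable def pathMul (p q : QuiverPath Q) : PathAlgebra k Q :=
  if h : p.2.1 = q.1 then ofPath k (p.2.2.comp (q.2.2.cast h.symm rfl)) else 0

/-- The multiplication of `kQ`: the bilinear extension of the product of paths. -/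
noncomputable def mulHom (Q : Type v) [Quiver.{w} Q] :
    PathAlgebra k Q →ₗ[k] PathAlgebra k Q →ₗ[k] PathAlgebra k Q :=
  (pathBasis k Q).constr k fun p => (pathBasis k Q).constr k fun q => pathMul k p q

noncomputable instance : Mul (PathAlgebra k Q) := ⟨fun x y => mulHom k Q x y⟩

/-- The unit of `kQ` is the sum of all vertices. -/
noncomputable instance [Fintype Q] : One (PathAlgebra k Q) :=
  ⟨∑ a : Q, ofPath k (Quiver.Path.nil : Quiver.Path a a)⟩

theorem mul_def (x y : PathAlgebra k Q) : x * y = mulHom k Q x y := rfl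

theorem one_def [Fintype Q] :
    (1 : PathAlgebra k Q) = ∑ a : Q, ofPath k (Quiver.Path.nil : Quiver.Path a a) := rfl

theorem ofPath_mul_eq_pathMul {a b c d : Q} (p : Quiver.Path a b) (q : Quiver.Path c d) :
    ofPath k p * ofPath k q = pathMul k ⟨a, b, p⟩ ⟨c, d, q⟩ := by
  rw [mul_def, ← pathBasis_apply k ⟨a, b, p⟩, ← pathBasis_apply k ⟨c, d, q⟩, mulHom,
    Module.Basis.constr_basis, Module.Basis.constr_basis]

theorem ofPath_mul_ofPath {a b c : Q} (p : Quiver.Path a b) (q : Quiver.Path b c) :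
    ofPath k p * ofPath k q = ofPath k (p.comp q) := by
  rw [ofPath_mul_eq_pathMul, pathMul, dif_pos rfl, Quiver.Path.cast_rfl_rfl]

theorem ofPath_mul_ofPath_of_ne {a b c d : Q} (p : Quiver.Path a b) (q : Quiver.Path c d)
    (h : b ≠ c) : ofPath k p * ofPath k q = 0 := by
  rw [ofPath_mul_eq_pathMul, pathMul, dif_neg h]

/-- A linear statement holds on `kQ` as soon as it holds for paths. -/
theorem induction_path {P : PathAlgebra k Q → Prop} (x : PathAlgebra k Q) (h0 : P 0)
    (hadd : ∀ x y, P x → P y → P (x + y)) (hsmul : ∀ (c : k) x, P x → P (c • x))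
    (hp : ∀ (a b : Q) (p : Quiver.Path a b), P (ofPath k p)) : P x := by
  have hx : x ∈ Submodule.span k (Set.range (pathBasis k Q)) := (pathBasis k Q).mem_span x
  induction hx using Submodule.span_induction with
  | mem y hy =>
    obtain ⟨p, rfl⟩ := hy
    exact hp _ _ _
  | zero => exact h0
  | add y z _ _ hy hz => exact hadd y z hy hz
  | smul c y _ hy => exact hsmul c y hy

theorem path_mul_assoc (x y z : PathAlgebra k Q) : x * y * z = x * (y * z) := by
  induction x using induction_path with
  | h0 => simp only [mul_def, map_zero, LinearMap.zero_apply]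
  | hadd _ _ h1 h2 => simp only [mul_def, map_add, LinearMap.add_apply] at *; rw [h1, h2]
  | hsmul _ _ h => simp only [mul_def, map_smul, LinearMap.smul_apply] at *; rw [h]
  | hp a b p =>
  induction y using induction_path with
  | h0 => simp only [mul_def, map_zero, LinearMap.zero_apply]
  | hadd _ _ h1 h2 => simp only [mul_def, map_add, LinearMap.add_apply] at *; rw [h1, h2]
  | hsmul _ _ h => simp only [mul_def, map_smul, LinearMap.smul_apply] at *; rw [h]
  | hp c d q =>
  induction z using induction_path with
  | h0 => simp only [mul_def, map_zero]
  | hadd _ _ h1 h2 => simp only [mul_def, map_add] at *; rw [h1, h2]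
  | hsmul _ _ h => simp only [mul_def, map_smul] at *; rw [h]
  | hp e f s =>
  have z1 : ∀ t : PathAlgebra k Q, 0 * t = 0 := fun t => by
    simp only [mul_def, map_zero, LinearMap.zero_apply]
  have z2 : ∀ t : PathAlgebra k Q, t * 0 = 0 := fun t => by
    simp only [mul_def, map_zero]
  by_cases h1 : b = c
  · subst h1
    by_cases h2 : d = e
    · subst h2
      simp only [ofPath_mul_ofPath, Quiver.Path.comp_assoc]
    · rw [ofPath_mul_ofPath, ofPath_mul_ofPath_of_ne k _ _ h2, ofPath_mul_ofPath_of_ne k _ _ h2, z2]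
  · rw [ofPath_mul_ofPath_of_ne k _ _ h1, z1]
    by_cases h2 : d = e
    · subst h2
      rw [ofPath_mul_ofPath, ofPath_mul_ofPath_of_ne k _ _ h1]
    · rw [ofPath_mul_ofPath_of_ne k _ _ h2, z2]

theorem path_one_mul [Fintype Q] (x : PathAlgebra k Q) : 1 * x = x := by
  induction x using induction_path with
  | h0 => simp only [mul_def, map_zero]
  | hadd _ _ h1 h2 => simp only [mul_def, map_add] at *; rw [h1, h2]
  | hsmul _ _ h => simp only [mul_def, map_smul] at *; rw [h]
  | hp a b p =>
  rw [one_def, mul_def, map_sum, LinearMap.sum_apply, Finset.sum_eq_single a]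
  · rw [← mul_def, ofPath_mul_ofPath, Quiver.Path.nil_comp]
  · intro c _ hc
    rw [← mul_def, ofPath_mul_ofPath_of_ne k _ _ hc]
  · intro h
    exact absurd (Finset.mem_univ a) h

theorem path_mul_one [Fintype Q] (x : PathAlgebra k Q) : x * 1 = x := by
  induction x using induction_path with
  | h0 => simp only [mul_def, map_zero, LinearMap.zero_apply]
  | hadd _ _ h1 h2 => simp only [mul_def, map_add, LinearMap.add_apply] at *; rw [h1, h2]
  | hsmul _ _ h => simp only [mul_def, map_smul, LinearMap.smul_apply] at *; rw [h]
  | hp a b p =>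
  rw [one_def, mul_def, map_sum, Finset.sum_eq_single b]
  · rw [← mul_def, ofPath_mul_ofPath, Quiver.Path.comp_nil]
  · intro c _ hc
    rw [← mul_def, ofPath_mul_ofPath_of_ne k _ _ hc.symm]
  · intro h
    exact absurd (Finset.mem_univ b) h

noncomputable instance [Fintype Q] : Ring (PathAlgebra k Q) where
  __ := (inferInstance : AddCommGroup (PathAlgebra k Q))
  __ := (inferInstance : Mul (PathAlgebra k Q))
  __ := (inferInstance : One (PathAlgebra k Q))
  mul_assoc := path_mul_assoc k
  one_mul := path_one_mul k
  mul_one := path_mul_one k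
  zero_mul _ := by simp only [mul_def, map_zero, LinearMap.zero_apply]
  mul_zero _ := by simp only [mul_def, map_zero]
  left_distrib _ _ _ := by simp only [mul_def, map_add]
  right_distrib _ _ _ := by simp only [mul_def, map_add, LinearMap.add_apply]

noncomputable instance [Fintype Q] : Algebra k (PathAlgebra k Q) :=
  Algebra.ofModule
    (fun r x y => by simp only [mul_def, map_smul, LinearMap.smul_apply])
    (fun r x y => by simp only [mul_def, map_smul])

/-- The element of `kQ` given by an arrow. -/
noncomputable def ofArrow {a b : Q} (f : a ⟶ b) : PathAlgebra k Q := ofPath k f.toPath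

end PathAlgebra

end PathAlgebra

/-! ## The algebras `B_r` -/

section AlgebraB

universe u

/-- The three vertices `1`, `2`, `3` of the quiver of `B_r`. -/
inductive BVertex : Type
  | v1
  | v2
  | v3
  deriving DecidableEq

instance : Fintype BVertex where
  elems := {.v1, .v2, .v3}
  complete x := by cases x <;> simp

/-- The six arrows of the quiver of `B_r`; `BArrow a b` is the type of arrows from `a` to `b`. -/
inductive BArrow : BVertex → BVertex → Type
  | c₁ : BArrow .v1 .v2
  | c₂ : BArrow .v2 .v3
  | c₃ : BArrow .v3 .v1
  | d₁ : BArrow .v2 .v1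
  | d₂ : BArrow .v3 .v2
  | d₃ : BArrow .v1 .v3

instance : Quiver BVertex := ⟨BArrow⟩

variable (k : Type u) [Field k]

/-- An arrow of the quiver of `B_r` as an element of the path algebra. -/
noncomputable def bArrow {a b : BVertex} (f : BArrow a b) : PathAlgebra k BVertex :=
  PathAlgebra.ofArrow k (show a ⟶ b from f)

open BArrow in
/-- The defining relations of `B_r`. -/
inductive BRel (r : ℕ) : PathAlgebra k BVertex → PathAlgebra k BVertex → Prop
  | c₁c₂ : BRel r (bArrow k c₁ * bArrow k c₂) 0
  | c₂c₃ : BRel r (bArrow k c₂ * bArrow k c₃) 0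
  | c₃c₁ : BRel r (bArrow k c₃ * bArrow k c₁) 0
  | d₁d₃ : BRel r (bArrow k d₁ * bArrow k d₃) 0
  | d₃d₂ : BRel r (bArrow k d₃ * bArrow k d₂) 0
  | d₂d₁ : BRel r (bArrow k d₂ * bArrow k d₁) 0
  | c₁d₁ : BRel r (bArrow k c₁ * bArrow k d₁) (bArrow k d₃ * bArrow k c₃)
  | d₁c₁ : BRel r (bArrow k d₁ * bArrow k c₁) ((bArrow k c₂ * bArrow k d₂) ^ r)
  | c₃d₃ : BRel r (bArrow k c₃ * bArrow k d₃) ((bArrow k d₂ * bArrow k c₂) ^ r)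

/-- The algebra `B_r = kQ/I`, where `I` is the two-sided ideal generated by the relations. -/
abbrev AlgB (r : ℕ) : Type u := RingQuot (BRel k r)

end AlgebraB

/-! ## Tightly graded algebras -/

section Tight

universe u v

variable (k : Type u) (A : Type v) [Field k] [Ring A] [Algebra k A]

/-- The power `rad^i A` of the Jacobson radical, as a subspace; `rad^0 A = A`. -/
def radPow (i : ℕ) : Submodule k A := (Ring.jacobson A ^ i).restrictScalars k

/-- The layer `rad^i A / rad^(i+1) A` of the radical filtration. -/
def RadLayer (i : ℕ) : Type v :=
  radPow k A i ⧸ (radPow k A (i + 1)).submoduleOf (radPow k A i)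

instance (i : ℕ) : AddCommGroup (RadLayer k A i) :=
  inferInstanceAs (AddCommGroup (radPow k A i ⧸ (radPow k A (i + 1)).submoduleOf (radPow k A i)))

instance (i : ℕ) : Module k (RadLayer k A i) :=
  inferInstanceAs (Module k (radPow k A i ⧸ (radPow k A (i + 1)).submoduleOf (radPow k A i)))

namespace RadLayer

variable {A}

theorem mem_radPow_zero (x : A) : x ∈ radPow k A 0 := by
  change x ∈ Ring.jacobson A ^ 0
  rw [Submodule.pow_zero]
  simp

theorem mul_mem_radPow {i j : ℕ} {x y : A} (hx : x ∈ radPow k A i) (hy : y ∈ radPow k A j) :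
    x * y ∈ radPow k A (i + j) := by
  change x * y ∈ Ring.jacobson A ^ (i + j)
  rw [Ideal.IsTwoSided.pow_add]
  exact Ideal.mul_mem_mul hx hy

/-- The class in `rad^i A / rad^(i+1) A` of an element of `rad^i A`. -/
def mk (i : ℕ) (x : A) (hx : x ∈ radPow k A i) : RadLayer k A i := Submodule.Quotient.mk ⟨x, hx⟩

theorem mk_eq_zero {i : ℕ} {x : A} (hx : x ∈ radPow k A i) (hx' : x ∈ radPow k A (i + 1)) :
    mk k i x hx = 0 :=
  (Submodule.Quotient.mk_eq_zero _).2 hx'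

theorem exists_mk {i : ℕ} (a : RadLayer k A i) : ∃ x hx, a = mk k i x hx := by
  obtain ⟨⟨x, hx⟩, rfl⟩ := Submodule.Quotient.mk_surjective _ a
  exact ⟨x, hx, rfl⟩

/-- The multiplication `rad^i × rad^j → rad^(i+j) / rad^(i+j+1)`. -/
def preMul (i j : ℕ) : radPow k A i →ₗ[k] radPow k A j →ₗ[k] RadLayer k A (i + j) :=
  LinearMap.mk₂ k (fun x y => mk k (i + j) (x.1 * y.1) (mul_mem_radPow k x.2 y.2))
    (fun x x' y => congrArg Submodule.Quotient.mk (Subtype.ext (add_mul x.1 x'.1 y.1)))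
    (fun c x y => congrArg Submodule.Quotient.mk (Subtype.ext (smul_mul_assoc c x.1 y.1)))
    (fun x y y' => congrArg Submodule.Quotient.mk (Subtype.ext (mul_add x.1 y.1 y'.1)))
    (fun c x y => congrArg Submodule.Quotient.mk (Subtype.ext (mul_smul_comm c x.1 y.1)))

/-- The multiplication `(x + rad^(i+1)) * (y + rad^(j+1)) = x * y + rad^(i+j+1)` of the associated
graded algebra. -/
def mulHom (i j : ℕ) : RadLayer k A i →ₗ[k] RadLayer k A j →ₗ[k] RadLayer k A (i + j) :=
  Submodule.liftQ _
    (LinearMap.flip (Submodule.liftQ _ (preMul k i j).flip (fun y hy => by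
      rw [LinearMap.mem_ker]
      refine LinearMap.ext fun x => ?_
      refine mk_eq_zero k (mul_mem_radPow k x.2 y.2) ?_
      have h : (y : A) ∈ radPow k A (j + 1) := hy
      have := mul_mem_radPow k x.2 h
      rwa [← add_assoc] at this)))
    (fun x hx => by
      rw [LinearMap.mem_ker]
      refine LinearMap.ext fun b => ?_
      obtain ⟨y, hy, rfl⟩ := exists_mk k b
      refine mk_eq_zero k (mul_mem_radPow k x.2 hy) ?_
      have h : (x : A) ∈ radPow k A (i + 1) := hx
      have := mul_mem_radPow k h hy
      rwa [add_right_comm] at this)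

instance : GradedMonoid.GOne (RadLayer k A) := ⟨mk k 0 1 (mem_radPow_zero k 1)⟩

instance : GradedMonoid.GMul (RadLayer k A) := ⟨fun {i j} a b => mulHom k i j a b⟩

theorem mk_congr {i j : ℕ} {x y : A} (hij : i = j) (hxy : x = y) (hx : x ∈ radPow k A i)
    (hy : y ∈ radPow k A j) :
    GradedMonoid.mk (A := RadLayer k A) i (mk k i x hx) = GradedMonoid.mk j (mk k j y hy) := by
  subst hij hxy
  rfl

theorem mk_mul_mk {i j : ℕ} {x y : A} (hx : x ∈ radPow k A i) (hy : y ∈ radPow k A j) :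
    GradedMonoid.mk (A := RadLayer k A) i (mk k i x hx) * GradedMonoid.mk j (mk k j y hy)
      = GradedMonoid.mk (i + j) (mk k (i + j) (x * y) (mul_mem_radPow k hx hy)) := rfl

instance : DirectSum.GSemiring (RadLayer k A) where
  mul_zero _ := map_zero _
  zero_mul _ := by
    change mulHom k _ _ 0 _ = 0
    rw [map_zero, LinearMap.zero_apply]
  mul_add _ _ _ := map_add _ _ _
  add_mul _ _ _ := by
    change mulHom k _ _ (_ + _) _ = mulHom k _ _ _ _ + mulHom k _ _ _ _
    rw [map_add, LinearMap.add_apply]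
  one_mul := by
    rintro ⟨i, a⟩
    obtain ⟨x, hx, rfl⟩ := exists_mk k a
    exact mk_congr k (zero_add i) (one_mul x) _ _
  mul_one := by
    rintro ⟨i, a⟩
    obtain ⟨x, hx, rfl⟩ := exists_mk k a
    exact mk_congr k (add_zero i) (mul_one x) _ _
  mul_assoc := by
    rintro ⟨i, a⟩ ⟨j, b⟩ ⟨l, c⟩
    obtain ⟨x, hx, rfl⟩ := exists_mk k a
    obtain ⟨y, hy, rfl⟩ := exists_mk k b
    obtain ⟨z, hz, rfl⟩ := exists_mk k c
    exact mk_congr k (add_assoc i j l) (mul_assoc x y z) _ _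
  natCast n := mk k 0 n (mem_radPow_zero k _)
  natCast_zero := by
    refine mk_eq_zero k _ ?_
    rw [Nat.cast_zero]
    exact zero_mem _
  natCast_succ n := congrArg Submodule.Quotient.mk (Subtype.ext (Nat.cast_succ n))

instance : DirectSum.GRing (RadLayer k A) where
  intCast n := mk k 0 n (mem_radPow_zero k _)
  intCast_ofNat n := congrArg Submodule.Quotient.mk (Subtype.ext (Int.cast_natCast n))
  intCast_negSucc_ofNat n := congrArg Submodule.Quotient.mk (Subtype.ext (by simp))

instance : DirectSum.GAlgebra k (RadLayer k A) where
  toFun :=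
    { toFun := fun r => mk k 0 (algebraMap k A r) (mem_radPow_zero k _)
      map_zero' := by
        refine mk_eq_zero k _ ?_
        rw [map_zero]
        exact zero_mem _
      map_add' := fun r s => congrArg Submodule.Quotient.mk (Subtype.ext (map_add _ r s)) }
  map_one := congrArg Submodule.Quotient.mk (Subtype.ext (map_one (algebraMap k A)))
  map_mul r s := mk_congr k rfl (map_mul (algebraMap k A) r s) _ _
  commutes := by
    rintro r ⟨i, a⟩
    obtain ⟨x, hx, rfl⟩ := exists_mk k a
    exact mk_congr k (add_comm 0 i) (Algebra.commutes r x) _ _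
  smul_def := by
    rintro r ⟨i, a⟩
    obtain ⟨x, hx, rfl⟩ := exists_mk k a
    exact mk_congr k (zero_add i).symm (Algebra.smul_def r x) (Submodule.smul_mem _ r hx) _

end RadLayer

/-- The graded algebra `gr_{rad A}(A) = ⨁_{i ≥ 0} rad^i A / rad^(i+1) A` of the radical
filtration. -/
abbrev RadGraded : Type v := DirectSum ℕ (RadLayer k A)

/-- `A` is tightly graded if it is isomorphic, as an algebra, to `gr_{rad A}(A)`. -/
def IsTightlyGraded : Prop := Nonempty (A ≃ₐ[k] RadGraded k A)

/-- A grading `A = ⨁_{i ≥ 0} A_i` is tight if `A_0` is semisimple and `A` is generated, as an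
algebra, by `A_0` and `A_1`. -/
def IsTightGrading {A : Type v} [Ring A] [Algebra k A] (𝒜 : ℕ → Submodule k A)
    [GradedAlgebra 𝒜] : Prop :=
  IsSemisimpleRing (𝒜 0) ∧ Algebra.adjoin k ((𝒜 0 : Set A) ∪ (𝒜 1 : Set A)) = ⊤

/-- `A` has a tight grading. -/
def HasTightGrading : Prop :=
  ∃ (𝒜 : ℕ → Submodule k A) (_ : GradedAlgebra 𝒜), IsTightGrading k 𝒜

end Tight

/-!
Since `rad B_r` is the ideal `J` generated by the arrows and `J` is nilpotent, everything is decided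
by the position of the relations relative to the powers of `J`.

A finite-dimensional algebra `A` with a tight grading `𝒜` is tightly graded: `rad A` is the part of
positive degree (`ringJacobson_eq_ker_projZero`), generation in degrees zero and one gives
`rad^n A = ⨁_{i ≥ n} 𝒜 i` (`radPow_eq_degreeGE`), and so `𝒜 i` is a complement of `rad^(i+1) A` in
`rad^i A` (`isTightlyGraded_of_isTightGrading`). It remains to grade `B_1` tightly, and to show that
`B_r` is not tightly graded for `r ≥ 2`.

For `r = 1` all relations are homogeneous of degree two, so path length is a tight grading
(`AlgB.isTightGrading_lengthSpan`).

For `r ≥ 2` the right socles differ. In `B_r` every `x` with `x * rad = 0` lies in `rad^2`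
(`AlgB.mem_of_forall_mul_eq_zero`): `B_r` has no simple projective module, and every arrow can be
prolonged on the right to a nonzero path in the socle. In the graded algebra the class of `d₁` in
degree one is annihilated by everything of positive degree, because `d₁ c₁ = (c₂ d₂)^r` lies in
`rad^(2r)` and hence in `rad^3`, and yet this class is not in the square of the radical
(`AlgB.not_isTightlyGraded`).

Two matrix representations replace a basis of `B_r`. Over the dual numbers, with every arrow equal
to `ε` times a matrix unit, one sees that vertices and arrows are independent modulo `rad^2`
(`AlgB.dualFamily`). Over an endomorphism ring containing operators `X`, `Y`, `Z` with pairwise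
products zero and `X^2 = Z^2 = Y^(2r) ≠ 0`, one sees that the socle elements `c₁ d₁`, `d₁ c₁` and
`c₃ d₃` are nonzero (`AlgB.socleFamily`). Neither the characteristic nor algebraic closedness plays
a role.
-/

/-! ### The universal property of the path algebra -/

section PathAlgebraLift

universe u v w x

namespace PathAlgebra

variable {k : Type u} {Q : Type v} [Field k] [Quiver.{w} Q]
variable {S : Type x} [Ring S] [Algebra k S]

/-- The value of a path in an algebra `S`, given the images of the vertices and of the arrows. -/
def evalPath (e : Q → S) (g : ∀ {a b : Q}, (a ⟶ b) → S) : ∀ {a b : Q}, Quiver.Path a b → S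
  | a, _, Quiver.Path.nil => e a
  | _, _, Quiver.Path.cons p f => evalPath e g p * g f

theorem evalPath_nil (e : Q → S) (g : ∀ {a b : Q}, (a ⟶ b) → S) (a : Q) :
    evalPath e g (Quiver.Path.nil : Quiver.Path a a) = e a := by
  rw [evalPath]

theorem evalPath_cons (e : Q → S) (g : ∀ {a b : Q}, (a ⟶ b) → S) {a b c : Q}
    (p : Quiver.Path a b) (f : b ⟶ c) : evalPath e g (p.cons f) = evalPath e g p * g f := by
  rw [evalPath]

variable {e : Q → S} {g : ∀ {a b : Q}, (a ⟶ b) → S}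

theorem mul_evalPath (he : ∀ a, e a * e a = e a) {a b : Q}
    (p : Quiver.Path a b) : e a * evalPath e g p = evalPath e g p := by
  induction p with
  | nil => rw [evalPath_nil, he]
  | cons p f ih => rw [evalPath_cons, ← mul_assoc, ih]

theorem evalPath_mul (he : ∀ a, e a * e a = e a)
    (hr : ∀ {a b : Q} (f : a ⟶ b), g f * e b = g f) {a b : Q}
    (p : Quiver.Path a b) : evalPath e g p * e b = evalPath e g p := by
  cases p with
  | nil => rw [evalPath_nil, he]
  | cons p f => rw [evalPath_cons, mul_assoc, hr]

theorem evalPath_comp (he : ∀ a, e a * e a = e a)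
    (hr : ∀ {a b : Q} (f : a ⟶ b), g f * e b = g f) {a b c : Q}
    (p : Quiver.Path a b) (q : Quiver.Path b c) :
    evalPath e g (p.comp q) = evalPath e g p * evalPath e g q := by
  induction q with
  | nil => rw [evalPath_nil, evalPath_mul he hr, Quiver.Path.comp_nil]
  | cons q f ih => rw [Quiver.Path.comp_cons, evalPath_cons, ih, evalPath_cons, mul_assoc]

variable [Fintype Q]

/-- The universal property of the path algebra: a complete family of orthogonal idempotents `e a`
of `S` together with elements `g f ∈ e a * S * e b` for the arrows `f : a ⟶ b` determines an algebra
homomorphism from `kQ` to `S`. -/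
noncomputable def lift (e : Q → S) (g : ∀ {a b : Q}, (a ⟶ b) → S) (he : ∀ a, e a * e a = e a)
    (hne : ∀ a b, a ≠ b → e a * e b = 0) (hone : ∑ a, e a = 1)
    (hr : ∀ {a b : Q} (f : a ⟶ b), g f * e b = g f) : PathAlgebra k Q →ₐ[k] S :=
  AlgHom.ofLinearMap
    ((pathBasis k Q).constr k fun p => evalPath e g p.2.2 : PathAlgebra k Q →ₗ[k] S)
    (by
      rw [one_def, map_sum, ← hone]
      refine Finset.sum_congr rfl fun a _ => ?_
      exact ((pathBasis k Q).constr_basis k _ ⟨a, a, Quiver.Path.nil⟩).trans (evalPath_nil e g a))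
    (by
      intro x y
      have key : ∀ {a b : Q} (p : Quiver.Path a b),
          ((pathBasis k Q).constr k fun p => evalPath e g p.2.2 : PathAlgebra k Q →ₗ[k] S)
            (ofPath k p) = evalPath e g p :=
        fun {a b} p => (pathBasis k Q).constr_basis k _ ⟨a, b, p⟩
      induction x using induction_path with
      | h0 => simp
      | hadd _ _ h1 h2 => rw [add_mul, map_add, h1, h2, map_add, add_mul]
      | hsmul _ _ h => rw [smul_mul_assoc, map_smul, h, map_smul, smul_mul_assoc]
      | hp a b p =>
      induction y using induction_path with
      | h0 => simp
      | hadd _ _ h1 h2 => rw [mul_add, map_add, h1, h2, map_add, mul_add]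
      | hsmul _ _ h => rw [mul_smul_comm, map_smul, h, map_smul, mul_smul_comm]
      | hp c d q =>
      by_cases h : b = c
      · subst h
        rw [ofPath_mul_ofPath, key, key, key, evalPath_comp he hr]
      · rw [ofPath_mul_ofPath_of_ne k _ _ h, map_zero, key, key, ← evalPath_mul he hr p,
          ← mul_evalPath he q, mul_assoc, ← mul_assoc (e b), hne b c h, zero_mul, mul_zero])

theorem lift_ofPath (he : ∀ a, e a * e a = e a)
    (hne : ∀ a b, a ≠ b → e a * e b = 0) (hone : ∑ a, e a = 1)
    (hr : ∀ {a b : Q} (f : a ⟶ b), g f * e b = g f) {a b : Q} (p : Quiver.Path a b) :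
    lift e g he hne hone hr (ofPath k p) = evalPath e g p :=
  (pathBasis k Q).constr_basis k _ ⟨a, b, p⟩

theorem lift_ofArrow (he : ∀ a, e a * e a = e a)
    (hne : ∀ a b, a ≠ b → e a * e b = 0) (hone : ∑ a, e a = 1)
    (hl : ∀ {a b : Q} (f : a ⟶ b), e a * g f = g f)
    (hr : ∀ {a b : Q} (f : a ⟶ b), g f * e b = g f) {a b : Q} (f : a ⟶ b) :
    lift e g he hne hone hr (ofArrow k f) = g f := by
  rw [ofArrow, lift_ofPath]
  rw [Quiver.Hom.toPath, evalPath_cons, evalPath_nil, hl]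

end PathAlgebra

end PathAlgebraLift

/-! ### Tight gradings and the radical filtration -/

section TightGrading

open DirectSum

variable {k A : Type*} [Field k] [Ring A] [Algebra k A]

/-- A left ideal all of whose elements are nilpotent lies in the Jacobson radical. -/
theorem Ideal.le_ringJacobson_of_isNilpotent (I : Ideal A) (h : ∀ x ∈ I, IsNilpotent x) :
    I ≤ Ring.jacobson A := by
  intro x hx
  rw [← Ideal.jacobson_bot, Ideal.mem_jacobson_iff]
  intro y
  obtain ⟨u, hu⟩ := (h _ (I.mul_mem_left y hx)).isUnit_one_add
  refine ⟨(u⁻¹ : Aˣ), ?_⟩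
  have : (↑u⁻¹ : A) * (1 + y * x) = 1 := by rw [← hu, Units.inv_mul]
  rw [Ideal.mem_bot, mul_assoc, ← this]
  noncomm_ring

/-- A surjective ring homomorphism to a semisimple ring kills the Jacobson radical. -/
theorem RingHom.map_eq_zero_of_mem_jacobson {B : Type*} [Ring B] [IsSemisimpleRing B]
    (f : A →+* B) (hf : Function.Surjective f) {x : A} (hx : x ∈ Ring.jacobson A) : f x = 0 := by
  have : RingHomSurjective f := ⟨hf⟩
  have := Ring.le_comap_jacobson f hx
  rwa [Ideal.mem_comap, IsSemisimpleRing.jacobson_eq_bot, Ideal.mem_bot] at this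

variable (𝒜 : ℕ → Submodule k A) [GradedAlgebra 𝒜]

theorem coe_decompose_mul_apply (x y : A) (n : ℕ) : (decompose 𝒜 (x * y) n : A) =
    ∑ ij ∈ Finset.HasAntidiagonal.antidiagonal n,
      (decompose 𝒜 x ij.1 : A) * (decompose 𝒜 y ij.2 : A) := by
  rw [decompose_mul, coe_mul_apply_eq_sum_antidiagonal]

/-- The subspace `⨁_{i ≥ n} 𝒜 i` of a graded algebra. -/
def degreeGE (n : ℕ) : Submodule k A :=
  ⨅ i, ⨅ _ : i < n, LinearMap.ker (GradedAlgebra.proj 𝒜 i)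

theorem mem_degreeGE {n : ℕ} {x : A} :
    x ∈ degreeGE 𝒜 n ↔ ∀ i < n, (decompose 𝒜 x i : A) = 0 := by
  simp only [degreeGE, Submodule.mem_iInf, LinearMap.mem_ker, GradedAlgebra.proj_apply]

theorem mul_mem_degreeGE {m n : ℕ} {x y : A} (hx : x ∈ degreeGE 𝒜 m) (hy : y ∈ degreeGE 𝒜 n) :
    x * y ∈ degreeGE 𝒜 (m + n) := by
  rw [mem_degreeGE] at *
  intro i hi
  rw [coe_decompose_mul_apply]
  refine Finset.sum_eq_zero fun ij hij => ?_
  rw [Finset.HasAntidiagonal.mem_antidiagonal] at hij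
  by_cases h : ij.1 < m
  · rw [hx _ h, zero_mul]
  · rw [hy _ (by omega), mul_zero]

theorem mem_degreeGE_of_mem {n : ℕ} {x : A} (hx : x ∈ 𝒜 n) : x ∈ degreeGE 𝒜 n := by
  rw [mem_degreeGE]
  intro i hi
  exact decompose_of_mem_ne 𝒜 hx hi.ne'

/-- A grading of a finite-dimensional algebra is bounded. -/
theorem exists_degreeGE_eq_bot [Module.Finite k A] : ∃ N, degreeGE 𝒜 N = ⊥ := by
  have hfin : {i | 𝒜 i ≠ ⊥}.Finite := WellFoundedGT.finite_ne_bot_of_iSupIndep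
    (Decomposition.isInternal 𝒜).submodule_iSupIndep
  obtain ⟨N, hN⟩ := hfin.bddAbove
  refine ⟨N + 1, eq_bot_iff.2 fun x hx => ?_⟩
  rw [mem_degreeGE] at hx
  rw [Submodule.mem_bot, ← (decompose 𝒜).injective.eq_iff, decompose_zero]
  refine DFinsupp.ext fun i => Subtype.ext ?_
  by_cases hi : i < N + 1
  · exact hx i hi
  · have h0 : 𝒜 i = ⊥ := by
      by_contra h
      exact hi (Nat.lt_succ_of_le (hN h))
    exact (Submodule.mem_bot k).1 (h0 ▸ (decompose 𝒜 x i).2)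

theorem mem_ker_projZero {x : A} :
    x ∈ RingHom.ker (GradedRing.projZeroRingHom' 𝒜) ↔ x ∈ degreeGE 𝒜 1 := by
  rw [mem_degreeGE, RingHom.mem_ker, Subtype.ext_iff]
  simp

theorem pow_mem_degreeGE {x : A} (hx : x ∈ degreeGE 𝒜 1) (n : ℕ) : x ^ n ∈ degreeGE 𝒜 n := by
  induction n with
  | zero => simp [mem_degreeGE]
  | succ n ih => exact pow_succ x n ▸ mul_mem_degreeGE 𝒜 ih hx

/-- The radical of a finite-dimensional graded algebra with semisimple degree zero part consists of
the elements without term of degree zero. -/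
theorem ringJacobson_eq_ker_projZero [Module.Finite k A] (h0 : IsSemisimpleRing (𝒜 0)) :
    Ring.jacobson A = RingHom.ker (GradedRing.projZeroRingHom' 𝒜) := by
  refine le_antisymm (fun x hx => ?_) (Ideal.le_ringJacobson_of_isNilpotent _ fun x hx => ?_)
  · exact RingHom.map_eq_zero_of_mem_jacobson (GradedRing.projZeroRingHom' 𝒜)
      (GradedRing.projZeroRingHom'_surjective 𝒜) hx
  · obtain ⟨N, hN⟩ := exists_degreeGE_eq_bot 𝒜
    refine ⟨N, ?_⟩
    have := pow_mem_degreeGE 𝒜 ((mem_ker_projZero 𝒜).1 hx) N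
    rwa [hN, Submodule.mem_bot] at this

/-- For a tight grading, `rad^n A = ⨁_{i ≥ n} 𝒜 i`. The inclusion from right to left holds because
the elements whose component of degree `n` lies in `rad^n A` for all `n` form a subalgebra that
contains the generators. -/
theorem radPow_eq_degreeGE [Module.Finite k A] (h : IsTightGrading k 𝒜) (n : ℕ) :
    radPow k A n = degreeGE 𝒜 n := by
  have hJ : ∀ x : A, x ∈ radPow k A 1 ↔ x ∈ degreeGE 𝒜 1 := fun x => by
    rw [← mem_ker_projZero, ← ringJacobson_eq_ker_projZero 𝒜 h.1, radPow,
      Submodule.restrictScalars_mem, Submodule.pow_one]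
  refine le_antisymm ?_ ?_
  · induction n with
    | zero => exact fun x _ => (mem_degreeGE 𝒜).2 fun i hi => absurd hi (Nat.not_lt_zero i)
    | succ n ih =>
      intro x hx
      change x ∈ Ring.jacobson A ^ (n + 1) at hx
      rw [Ideal.IsTwoSided.pow_add, Submodule.pow_one] at hx
      refine Submodule.smul_induction_on hx (fun a ha b hb => ?_) fun a b => add_mem
      refine mul_mem_degreeGE 𝒜 (ih ha) ((hJ b).1 ?_)
      rwa [radPow, Submodule.restrictScalars_mem, Submodule.pow_one]
  · have key : ∀ x : A, ∀ m, (decompose 𝒜 x m : A) ∈ radPow k A m := by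
      intro x
      have hx : x ∈ Algebra.adjoin k ((𝒜 0 : Set A) ∪ (𝒜 1 : Set A)) := h.2 ▸ Algebra.mem_top
      induction hx using Algebra.adjoin_induction with
      | mem x hx =>
        intro m
        rcases hx with hx | hx
        · by_cases hm : m = 0
          · subst hm
            exact RadLayer.mem_radPow_zero k _
          · rw [decompose_of_mem_ne 𝒜 hx (Ne.symm hm)]
            exact zero_mem _
        · by_cases hm : m = 1
          · subst hm
            exact (hJ _).2 (mem_degreeGE_of_mem 𝒜 (decompose 𝒜 x 1).2)
          · rw [decompose_of_mem_ne 𝒜 hx (Ne.symm hm)]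
            exact zero_mem _
      | algebraMap c =>
        intro m
        by_cases hm : m = 0
        · subst hm
          exact RadLayer.mem_radPow_zero k _
        · rw [decompose_of_mem_ne 𝒜 (SetLike.algebraMap_mem_graded 𝒜 c) (Ne.symm hm)]
          exact zero_mem _
      | add x y _ _ hx hy =>
        intro m
        rw [decompose_add, DirectSum.add_apply, Submodule.coe_add]
        exact add_mem (hx m) (hy m)
      | mul x y _ _ hx hy =>
        intro m
        rw [coe_decompose_mul_apply]
        refine sum_mem fun ij hij => ?_
        rw [← Finset.HasAntidiagonal.mem_antidiagonal.1 hij]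
        exact RadLayer.mul_mem_radPow k (hx _) (hy _)
    classical
    intro x hx
    rw [mem_degreeGE] at hx
    rw [← sum_support_decompose 𝒜 x]
    refine sum_mem fun i _ => ?_
    by_cases hi : i < n
    · rw [hx i hi]
      exact zero_mem _
    · exact Ideal.pow_le_pow_right (not_lt.1 hi) (key x i)

/-- For a tight grading, the component of degree `i` is a complement of `rad^(i+1) A` in
`rad^i A`. -/
noncomputable def componentEquivRadLayer [Module.Finite k A] (h : IsTightGrading k 𝒜) (i : ℕ) :
    𝒜 i ≃ₗ[k] RadLayer k A i :=
  LinearEquiv.ofBijective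
    ((Submodule.mkQ _).comp (Submodule.inclusion (p := 𝒜 i) (p' := radPow k A i) fun x hx =>
      radPow_eq_degreeGE 𝒜 h i ▸ mem_degreeGE_of_mem 𝒜 hx))
    (by
      constructor
      · rw [injective_iff_map_eq_zero]
        intro x hx
        have hx' : (x : A) ∈ radPow k A (i + 1) := by
          have h0 := (Submodule.Quotient.mk_eq_zero _).1 hx
          exact h0
        rw [radPow_eq_degreeGE 𝒜 h, mem_degreeGE] at hx'
        have := hx' i (Nat.lt_succ_self i)
        rwa [decompose_of_mem_same 𝒜 x.2, Submodule.coe_eq_zero] at this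
      · intro y
        obtain ⟨x, hx, rfl⟩ := RadLayer.exists_mk k y
        refine ⟨decompose 𝒜 x i, (Submodule.Quotient.eq _).2 ?_⟩
        change (decompose 𝒜 x i : A) - x ∈ radPow k A (i + 1)
        rw [radPow_eq_degreeGE 𝒜 h, mem_degreeGE] at *
        intro j hj
        rw [decompose_sub, DirectSum.sub_apply, decompose_coe, Submodule.coe_sub]
        rcases Nat.lt_succ_iff_lt_or_eq.1 hj with hj | rfl
        · rw [hx j hj, sub_zero, of_eq_of_ne _ _ _ hj.ne, Submodule.coe_zero]
        · rw [of_eq_same, sub_self])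

/-- A finite-dimensional algebra with a tight grading is isomorphic to the graded algebra of its
radical filtration. -/
theorem isTightlyGraded_of_isTightGrading [Module.Finite k A] (h : IsTightGrading k 𝒜) :
    IsTightlyGraded k A := by
  let F : (⨁ i, 𝒜 i) →ₐ[k] RadGraded k A :=
    DirectSum.toAlgebra k (fun i => 𝒜 i)
      (fun i => (lof k ℕ (RadLayer k A) i).comp (componentEquivRadLayer 𝒜 h i).toLinearMap)
      rfl
      (fun {i j} a b => (of_mul_of (A := RadLayer k A) (componentEquivRadLayer 𝒜 h i a)
        (componentEquivRadLayer 𝒜 h j b)).symm)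
  let L : (⨁ i, 𝒜 i) ≃ₗ[k] RadGraded k A :=
    DFinsupp.mapRange.linearEquiv (componentEquivRadLayer 𝒜 h)
  have hFL : F.toLinearMap = L.toLinearMap := by
    refine DirectSum.linearMap_ext k fun i => LinearMap.ext fun x => ?_
    refine (toModule_lof k (M := fun i => 𝒜 i) i x).trans ?_
    exact (DFinsupp.mapRange_single (hf := fun i => map_zero (componentEquivRadLayer 𝒜 h i))).symm
  have hF : Function.Bijective F := by
    have : (F : (⨁ i, 𝒜 i) → RadGraded k A) = L := congrArg DFunLike.coe hFL
    rw [this]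
    exact L.bijective
  exact ⟨(decomposeAlgEquiv 𝒜).trans (AlgEquiv.ofBijective F hF)⟩

end TightGrading

/-! ### The relations of `B_r` -/

namespace AlgB

open BVertex BArrow

variable (k : Type*) [Field k] (r : ℕ)

/-- The class in `B_r` of a path. -/
noncomputable def path {a b : BVertex} (p : Quiver.Path a b) : AlgB k r :=
  RingQuot.mkAlgHom k (BRel k r) (PathAlgebra.ofPath k p)

/-- The idempotent of `B_r` that belongs to a vertex. -/
noncomputable def vert (a : BVertex) : AlgB k r :=
  path k r (Quiver.Path.nil : Quiver.Path a a)

/-- The class in `B_r` of an arrow. -/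
noncomputable def arr {a b : BVertex} (f : BArrow a b) : AlgB k r :=
  RingQuot.mkAlgHom k (BRel k r) (bArrow k f)

theorem path_mul_path {a b c : BVertex} (p : Quiver.Path a b) (q : Quiver.Path b c) :
    path k r p * path k r q = path k r (p.comp q) := by
  rw [path, path, ← map_mul, PathAlgebra.ofPath_mul_ofPath, path]

theorem path_mul_path_of_ne {a b c d : BVertex} (p : Quiver.Path a b) (q : Quiver.Path c d)
    (h : b ≠ c) : path k r p * path k r q = 0 := by
  rw [path, path, ← map_mul, PathAlgebra.ofPath_mul_ofPath_of_ne k p q h, map_zero]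

theorem path_toPath {a b : BVertex} (f : a ⟶ b) : path k r f.toPath = arr k r f := rfl

theorem path_cons {a b c : BVertex} (p : Quiver.Path a b) (f : b ⟶ c) :
    path k r (p.cons f) = path k r p * arr k r f := by
  rw [← path_toPath, path_mul_path]
  rfl

theorem vert_mul_vert (a : BVertex) : vert k r a * vert k r a = vert k r a :=
  path_mul_path k r _ _

theorem vert_mul_vert_of_ne {a b : BVertex} (h : a ≠ b) : vert k r a * vert k r b = 0 :=
  path_mul_path_of_ne k r _ _ h

theorem sum_vert : ∑ a, vert k r a = 1 := by
  simp only [vert, path]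
  rw [← map_sum, ← PathAlgebra.one_def, map_one]

@[simp] theorem vert_mul_arr {a b : BVertex} (f : BArrow a b) :
    vert k r a * arr k r f = arr k r f := by
  rw [← path_toPath k r f, vert, path_mul_path, Quiver.Path.nil_comp]

@[simp] theorem vert_mul_arr_of_ne {a b c : BVertex} (f : BArrow a b) (h : c ≠ a) :
    vert k r c * arr k r f = 0 :=
  path_mul_path_of_ne k r _ (Quiver.Hom.toPath (show a ⟶ b from f)) h

@[simp] theorem arr_mul_vert {a b : BVertex} (f : BArrow a b) :
    arr k r f * vert k r b = arr k r f := by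
  rw [← path_toPath k r f, vert, path_mul_path, Quiver.Path.comp_nil]

@[simp] theorem arr_mul_vert_of_ne {a b c : BVertex} (f : BArrow a b) (h : b ≠ c) :
    arr k r f * vert k r c = 0 :=
  path_mul_path_of_ne k r (Quiver.Hom.toPath (show a ⟶ b from f)) _ h

@[simp] theorem arr_mul_arr_of_ne {a b c d : BVertex} (f : BArrow a b) (g : BArrow c d)
    (h : b ≠ c) : arr k r f * arr k r g = 0 :=
  path_mul_path_of_ne k r (Quiver.Hom.toPath (show a ⟶ b from f))
    (Quiver.Hom.toPath (show c ⟶ d from g)) h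

@[simp] theorem c₁_mul_c₂ : arr k r c₁ * arr k r c₂ = 0 := by
  simpa [arr] using RingQuot.mkAlgHom_rel k (BRel.c₁c₂ (k := k) (r := r))

@[simp] theorem c₂_mul_c₃ : arr k r c₂ * arr k r c₃ = 0 := by
  simpa [arr] using RingQuot.mkAlgHom_rel k (BRel.c₂c₃ (k := k) (r := r))

@[simp] theorem c₃_mul_c₁ : arr k r c₃ * arr k r c₁ = 0 := by
  simpa [arr] using RingQuot.mkAlgHom_rel k (BRel.c₃c₁ (k := k) (r := r))

@[simp] theorem d₁_mul_d₃ : arr k r d₁ * arr k r d₃ = 0 := by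
  simpa [arr] using RingQuot.mkAlgHom_rel k (BRel.d₁d₃ (k := k) (r := r))

@[simp] theorem d₃_mul_d₂ : arr k r d₃ * arr k r d₂ = 0 := by
  simpa [arr] using RingQuot.mkAlgHom_rel k (BRel.d₃d₂ (k := k) (r := r))

@[simp] theorem d₂_mul_d₁ : arr k r d₂ * arr k r d₁ = 0 := by
  simpa [arr] using RingQuot.mkAlgHom_rel k (BRel.d₂d₁ (k := k) (r := r))

theorem c₁_mul_d₁ : arr k r c₁ * arr k r d₁ = arr k r d₃ * arr k r c₃ := by
  simpa [arr] using RingQuot.mkAlgHom_rel k (BRel.c₁d₁ (k := k) (r := r))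

theorem d₁_mul_c₁ : arr k r d₁ * arr k r c₁ = (arr k r c₂ * arr k r d₂) ^ r := by
  simpa [arr] using RingQuot.mkAlgHom_rel k (BRel.d₁c₁ (k := k) (r := r))

theorem c₃_mul_d₃ : arr k r c₃ * arr k r d₃ = (arr k r d₂ * arr k r c₂) ^ r := by
  simpa [arr] using RingQuot.mkAlgHom_rel k (BRel.c₃d₃ (k := k) (r := r))

theorem c₁_mul_d₁_mul_c₁ : arr k r c₁ * (arr k r d₁ * arr k r c₁) = 0 := by
  rw [← mul_assoc, c₁_mul_d₁, mul_assoc, c₃_mul_c₁, mul_zero]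

theorem d₁_mul_c₁_mul_d₁ : arr k r d₁ * (arr k r c₁ * arr k r d₁) = 0 := by
  rw [c₁_mul_d₁, ← mul_assoc, d₁_mul_d₃, zero_mul]

theorem c₃_mul_d₃_mul_c₃ : arr k r c₃ * (arr k r d₃ * arr k r c₃) = 0 := by
  rw [← c₁_mul_d₁, ← mul_assoc, c₃_mul_c₁, zero_mul]

theorem d₃_mul_c₃_mul_d₃ : arr k r d₃ * (arr k r c₃ * arr k r d₃) = 0 := by
  rw [← mul_assoc, ← c₁_mul_d₁, mul_assoc, d₁_mul_d₃, mul_zero]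

variable {k r} in
/-- A subspace of `B_r` that contains the vertices and is closed under extending paths by one
arrow is everything. -/
theorem eq_top_of_path {N : Submodule k (AlgB k r)} (hv : ∀ a, vert k r a ∈ N)
    (ha : ∀ (a b c : BVertex) (p : Quiver.Path a b) (f : BArrow b c), path k r p ∈ N →
      path k r p * arr k r f ∈ N) : N = ⊤ := by
  refine Submodule.eq_top_iff'.2 fun x => ?_
  obtain ⟨x, rfl⟩ := RingQuot.mkAlgHom_surjective k (BRel k r) x
  induction x using PathAlgebra.induction_path with
  | h0 => rw [map_zero]; exact zero_mem _
  | hadd x y hx hy => rw [map_add]; exact add_mem hx hy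
  | hsmul c x hx => rw [map_smul]; exact N.smul_mem c hx
  | hp a b p =>
    induction p with
    | nil => exact hv a
    | cons p f ih =>
      change path k r (p.cons f) ∈ N
      rw [path_cons]
      exact ha _ _ _ p f ih

/-! ### Homomorphisms from `B_r` -/

/-- A family of elements of an algebra `S` that satisfies the defining relations of `B_r`. -/
structure Family (S : Type*) [Ring S] [Algebra k S] where
  /-- The images of the vertices. -/
  e : BVertex → S
  /-- The images of the arrows. -/
  g : ∀ {a b : BVertex}, BArrow a b → S
  e_mul_e : ∀ a, e a * e a = e a
  e_mul_e_of_ne : ∀ a b, a ≠ b → e a * e b = 0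
  sum_e : ∑ a, e a = 1
  e_mul_g : ∀ {a b : BVertex} (f : BArrow a b), e a * g f = g f
  g_mul_e : ∀ {a b : BVertex} (f : BArrow a b), g f * e b = g f
  c₁c₂ : g c₁ * g c₂ = 0
  c₂c₃ : g c₂ * g c₃ = 0
  c₃c₁ : g c₃ * g c₁ = 0
  d₁d₃ : g d₁ * g d₃ = 0
  d₃d₂ : g d₃ * g d₂ = 0
  d₂d₁ : g d₂ * g d₁ = 0
  c₁d₁ : g c₁ * g d₁ = g d₃ * g c₃
  d₁c₁ : g d₁ * g c₁ = (g c₂ * g d₂) ^ r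
  c₃d₃ : g c₃ * g d₃ = (g d₂ * g c₂) ^ r

namespace Family

variable {k r} {S : Type*} [Ring S] [Algebra k S] (F : Family k r S)

/-- The homomorphism from the path algebra given by a family. -/
noncomputable def pathHom : PathAlgebra k BVertex →ₐ[k] S :=
  PathAlgebra.lift F.e (fun f => F.g f) F.e_mul_e F.e_mul_e_of_ne F.sum_e fun f => F.g_mul_e f

theorem pathHom_bArrow {a b : BVertex} (f : BArrow a b) : F.pathHom (bArrow k f) = F.g f := by
  rw [pathHom, bArrow, PathAlgebra.lift_ofArrow]
  exact fun f => F.e_mul_g f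

/-- The homomorphism from `B_r` given by a family. -/
noncomputable def hom : AlgB k r →ₐ[k] S :=
  RingQuot.liftAlgHom k ⟨F.pathHom, fun x y h => by
    cases h <;> simp only [map_mul, map_pow, map_zero, pathHom_bArrow]
    exacts [F.c₁c₂, F.c₂c₃, F.c₃c₁, F.d₁d₃, F.d₃d₂, F.d₂d₁, F.c₁d₁, F.d₁c₁, F.c₃d₃]⟩

@[simp] theorem hom_vert (a : BVertex) : F.hom (vert k r a) = F.e a :=
  (RingQuot.liftAlgHom_mkAlgHom_apply k F.pathHom _ _).trans <|
    (PathAlgebra.lift_ofPath ..).trans (PathAlgebra.evalPath_nil ..)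

@[simp] theorem hom_arr {a b : BVertex} (f : BArrow a b) : F.hom (arr k r f) = F.g f :=
  (RingQuot.liftAlgHom_mkAlgHom_apply k F.pathHom _ _).trans (F.pathHom_bArrow f)

end Family

variable {k r}

/-- The family of vertices and zero arrows; it gives the three simple modules. -/
def simpleFamily (hr : 1 ≤ r) : Family k r (BVertex → k) where
  e a := Pi.single a 1
  g _ := 0
  e_mul_e a := by rw [← Pi.single_mul, mul_one]
  e_mul_e_of_ne a b h := by
    ext c
    by_cases hc : c = a
    · subst hc; simp [h]
    · simp [hc]
  sum_e := by ext c; simp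
  e_mul_g _ := mul_zero _
  g_mul_e _ := zero_mul _
  c₁c₂ := mul_zero _
  c₂c₃ := mul_zero _
  c₃c₁ := mul_zero _
  d₁d₃ := mul_zero _
  d₃d₂ := mul_zero _
  d₂d₁ := mul_zero _
  c₁d₁ := by simp
  d₁c₁ := by rw [mul_zero, zero_pow (by omega)]
  c₃d₃ := by rw [mul_zero, zero_pow (by omega)]

/-- The label of an arrow in the representation `matrixFamily`. -/
def label {R : Type*} (x y z : R) : ∀ {a b : BVertex}, BArrow a b → R
  | _, _, c₁ => x
  | _, _, d₁ => x
  | _, _, c₂ => y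
  | _, _, d₂ => y
  | _, _, c₃ => z
  | _, _, d₃ => z

theorem _root_.Matrix.single_self_pow {n R : Type*} [Fintype n] [DecidableEq n] [Semiring R]
    (i : n) (x : R) {m : ℕ} (hm : 1 ≤ m) : Matrix.single i i x ^ m = Matrix.single i i (x ^ m) := by
  induction m, hm using Nat.le_induction with
  | base => simp
  | succ m _ ih => rw [pow_succ, ih, Matrix.single_mul_single_same, pow_succ]

/-- Elements `x`, `y`, `z` of a `k`-algebra `R` with pairwise products zero and
`x ^ 2 = z ^ 2 = (y ^ 2) ^ r` give a representation of `B_r` by matrices over `R`. An arrow from `a`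
to `b` is sent to a matrix whose only entry is at `(a, b)`. -/
def matrixFamily (hr : 1 ≤ r) {R : Type*} [Ring R] [Algebra k R] (x y z : R) (hxy : x * y = 0)
    (hyx : y * x = 0) (hyz : y * z = 0) (hzy : z * y = 0) (hxz : x * z = 0) (hzx : z * x = 0)
    (hx : x * x = (y * y) ^ r) (hz : z * z = (y * y) ^ r) :
    Family k r (Matrix BVertex BVertex R) where
  e a := Matrix.single a a 1
  g {a b} f := Matrix.single a b (label x y z f)
  e_mul_e a := by simp
  e_mul_e_of_ne a b h := Matrix.single_mul_single_of_ne _ _ _ _ h _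
  sum_e := by
    ext i j
    simp only [Matrix.sum_apply, Matrix.single_apply, Matrix.one_apply, ite_and,
      Finset.sum_ite_eq', Finset.mem_univ, if_true]
  e_mul_g f := by simp
  g_mul_e f := by simp
  c₁c₂ := by simp [label, hxy]
  c₂c₃ := by simp [label, hyz]
  c₃c₁ := by simp [label, hzx]
  d₁d₃ := by simp [label, hxz]
  d₃d₂ := by simp [label, hzy]
  d₂d₁ := by simp [label, hyx]
  c₁d₁ := by simp [label, hx, hz]
  d₁c₁ := by simp [label, hx, Matrix.single_self_pow _ _ hr]
  c₃d₃ := by simp [label, hz, Matrix.single_self_pow _ _ hr]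

/-- The representation of `B_r` over the dual numbers in which every arrow has label `ε`. Its kernel
is the square of the radical. -/
def dualFamily (hr : 1 ≤ r) : Family k r (Matrix BVertex BVertex (DualNumber k)) :=
  have h : (DualNumber.eps * DualNumber.eps : DualNumber k) = 0 := DualNumber.eps_mul_eps
  have h' : (DualNumber.eps * DualNumber.eps : DualNumber k) =
      (DualNumber.eps * DualNumber.eps) ^ r := by rw [h, zero_pow (by omega)]
  matrixFamily hr DualNumber.eps DualNumber.eps DualNumber.eps h h h h h h h' h'

/-! ### A representation in which the socle survives -/

variable (k r)

/-- The truncated backward shift on the first factor of `(ℕ → k) × k × k`. -/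
def opY : Module.End k ((ℕ → k) × k × k) where
  toFun v := (fun n => if n < 2 * r then v.1 (n + 1) else 0, 0, 0)
  map_add' v w := by
    ext n <;> simp
    split_ifs <;> simp
  map_smul' c v := by
    ext n <;> simp

/-- The operator `(v, a, b) ↦ (a δ₀, v (2 r), 0)`. -/
def opX : Module.End k ((ℕ → k) × k × k) where
  toFun v := (Pi.single 0 v.2.1, v.1 (2 * r), 0)
  map_add' v w := by ext n <;> simp [Pi.single_add]
  map_smul' c v := by ext n <;> simp [Pi.single_apply]

/-- The operator `(v, a, b) ↦ (b δ₀, 0, v (2 r))`. -/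
def opZ : Module.End k ((ℕ → k) × k × k) where
  toFun v := (Pi.single 0 v.2.2, 0, v.1 (2 * r))
  map_add' v w := by ext n <;> simp [Pi.single_add]
  map_smul' c v := by ext n <;> simp [Pi.single_apply]

theorem opY_pow_apply (m : ℕ) (v : (ℕ → k) × k × k) :
    (opY k r ^ (m + 1)) v = (fun n => if n + m < 2 * r then v.1 (n + m + 1) else 0, 0, 0) := by
  induction m with
  | zero => rw [zero_add, pow_one]; rfl
  | succ m ih =>
    rw [pow_succ', Module.End.mul_apply, ih]
    simp only [opY, LinearMap.coe_mk, AddHom.coe_mk, Prod.mk.injEq, and_true]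
    funext n
    have h1 : n + 1 + m = n + (m + 1) := by omega
    rw [h1]
    by_cases h : n + (m + 1) < 2 * r
    · rw [if_pos h, if_pos (by omega)]
    · rw [if_neg h, ite_self]

variable {k r}

theorem opY_sq_pow (hr : 1 ≤ r) (v : (ℕ → k) × k × k) :
    ((opY k r * opY k r) ^ r) v = (Pi.single 0 (v.1 (2 * r)), 0, 0) := by
  obtain ⟨m, hm⟩ : ∃ m, 2 * r = m + 1 := ⟨2 * r - 1, by omega⟩
  rw [← pow_two, ← pow_mul, hm, opY_pow_apply, hm]
  refine Prod.ext (funext fun n => ?_) rfl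
  rcases Nat.eq_zero_or_pos n with rfl | hn
  · simp
  · simp [hn.ne']

/-- A representation of `B_r` in which no element of the socle vanishes. -/
def socleFamily (hr : 1 ≤ r) :
    Family k r (Matrix BVertex BVertex (Module.End k ((ℕ → k) × k × k))) :=
  have h2 : 2 * r ≠ 0 := by omega
  matrixFamily hr (opX k r) (opY k r) (opZ k r)
    (by ext v <;> simp [opX, opY])
    (by ext v <;> simp [opX, opY])
    (by ext v <;> simp [opZ, opY])
    (by ext v <;> simp [opZ, opY])
    (by ext v <;> simp [opX, opZ, h2])
    (by ext v <;> simp [opX, opZ, h2])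
    (LinearMap.ext fun v => by rw [opY_sq_pow hr]; simp [opX, h2])
    (LinearMap.ext fun v => by rw [opY_sq_pow hr]; simp [opZ, h2])

theorem opX_mul_opX_ne_zero (k : Type*) [Field k] (r : ℕ) : opX k r * opX k r ≠ 0 := by
  intro h
  have := congrArg (fun f : Module.End k ((ℕ → k) × k × k) => (f (fun _ => 1, 0, 0)).1 0) h
  simp [opX] at this

theorem opZ_mul_opZ_ne_zero (k : Type*) [Field k] (r : ℕ) : opZ k r * opZ k r ≠ 0 := by
  intro h
  have := congrArg (fun f : Module.End k ((ℕ → k) × k × k) => (f (fun _ => 1, 0, 0)).1 0) h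
  simp [opZ] at this

theorem c₁_mul_d₁_ne_zero (hr : 1 ≤ r) : arr k r c₁ * arr k r d₁ ≠ 0 := by
  intro h
  have := congrArg (fun x => (socleFamily hr).hom x v1 v1) h
  simp [socleFamily, matrixFamily, label] at this
  exact opX_mul_opX_ne_zero k r this

theorem d₁_mul_c₁_ne_zero (hr : 1 ≤ r) : arr k r d₁ * arr k r c₁ ≠ 0 := by
  intro h
  have := congrArg (fun x => (socleFamily hr).hom x v2 v2) h
  simp [socleFamily, matrixFamily, label] at this
  exact opX_mul_opX_ne_zero k r this

theorem c₃_mul_d₃_ne_zero (hr : 1 ≤ r) : arr k r c₃ * arr k r d₃ ≠ 0 := by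
  intro h
  have := congrArg (fun x => (socleFamily hr).hom x v3 v3) h
  simp [socleFamily, matrixFamily, label] at this
  exact opZ_mul_opZ_ne_zero k r this

end AlgB

namespace AlgB

open BVertex BArrow

variable (k : Type*) [Field k] (r : ℕ)

/-! ### The radical of `B_r` -/

/-- The span of the vertices in `B_r`. -/
noncomputable def vertSpan : Submodule k (AlgB k r) := Submodule.span k (Set.range (vert k r))

/-- The span of the arrows in `B_r`. -/
noncomputable def arrSpan : Submodule k (AlgB k r) :=
  Submodule.span k {arr k r c₁, arr k r c₂, arr k r c₃, arr k r d₁, arr k r d₂, arr k r d₃}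

theorem arrSpan_eq :
    arrSpan k r = Submodule.span k {x | ∃ (a b : BVertex) (f : BArrow a b), x = arr k r f} := by
  rw [arrSpan]
  congr 1
  ext x
  constructor
  · rintro (rfl | rfl | rfl | rfl | rfl | rfl) <;> exact ⟨_, _, _, rfl⟩
  · rintro ⟨a, b, f, rfl⟩
    cases f <;> simp

theorem arr_mem_arrSpan {a b : BVertex} (f : BArrow a b) : arr k r f ∈ arrSpan k r := by
  rw [arrSpan_eq]
  exact Submodule.subset_span ⟨a, b, f, rfl⟩

theorem vert_mem_vertSpan (a : BVertex) : vert k r a ∈ vertSpan k r :=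
  Submodule.subset_span ⟨a, rfl⟩

theorem vertSpan_mul_arrSpan : vertSpan k r * arrSpan k r ≤ arrSpan k r := by
  conv_lhs => rw [arrSpan_eq, vertSpan, Submodule.span_mul_span]
  rw [Submodule.span_le]
  rintro _ ⟨_, ⟨a, rfl⟩, _, ⟨b, c, f, rfl⟩, rfl⟩
  by_cases h : a = b
  · subst h
    simpa using arr_mem_arrSpan k r f
  · simp [h]

theorem arrSpan_mul_vertSpan : arrSpan k r * vertSpan k r ≤ arrSpan k r := by
  conv_lhs => rw [arrSpan_eq, vertSpan, Submodule.span_mul_span]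
  rw [Submodule.span_le]
  rintro _ ⟨_, ⟨b, c, f, rfl⟩, _, ⟨a, rfl⟩, rfl⟩
  by_cases h : c = a
  · subst h
    simpa using arr_mem_arrSpan k r f
  · simp [h]

theorem le_top_mul (N : Submodule k (AlgB k r)) : N ≤ ⊤ * N := fun x hx => by
  simpa using Submodule.mul_mem_mul (Submodule.mem_top (x := (1 : AlgB k r))) hx

theorem le_mul_top (N : Submodule k (AlgB k r)) : N ≤ N * ⊤ := fun x hx => by
  simpa using Submodule.mul_mem_mul hx (Submodule.mem_top (x := (1 : AlgB k r)))

theorem vertSpan_sup_top_mul : vertSpan k r ⊔ ⊤ * arrSpan k r = ⊤ :=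
  eq_top_of_path (fun a => Submodule.mem_sup_left (vert_mem_vertSpan k r a)) fun _ _ _ _ f _ =>
    Submodule.mem_sup_right (Submodule.mul_mem_mul Submodule.mem_top (arr_mem_arrSpan k r f))

theorem vertSpan_sup_mul_top : vertSpan k r ⊔ arrSpan k r * ⊤ = ⊤ := by
  refine eq_top_of_path (fun a => Submodule.mem_sup_left (vert_mem_vertSpan k r a))
    fun _ _ _ p f hp => Submodule.mem_sup_right ?_
  have h : (vertSpan k r ⊔ arrSpan k r * ⊤) * arrSpan k r ≤ arrSpan k r * ⊤ := by
    rw [Submodule.sup_mul, mul_assoc]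
    exact sup_le ((vertSpan_mul_arrSpan k r).trans (le_mul_top k r _))
      (mul_le_mul' le_rfl le_top)
  exact h (Submodule.mul_mem_mul hp (arr_mem_arrSpan k r f))

theorem top_mul_top : (⊤ : Submodule k (AlgB k r)) * ⊤ = ⊤ :=
  top_le_iff.1 (le_top_mul k r ⊤)

/-- Both sides are the span of the paths of positive length. -/
theorem top_mul_arrSpan : ⊤ * arrSpan k r = arrSpan k r * ⊤ := by
  refine le_antisymm ?_ ?_
  · conv_lhs => rw [← vertSpan_sup_mul_top, Submodule.sup_mul, mul_assoc]
    exact sup_le ((vertSpan_mul_arrSpan k r).trans (le_mul_top k r _))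
      (mul_le_mul' le_rfl le_top)
  · conv_lhs => rw [← vertSpan_sup_top_mul, Submodule.mul_sup, ← mul_assoc]
    exact sup_le ((arrSpan_mul_vertSpan k r).trans (le_top_mul k r _))
      (mul_le_mul' le_top le_rfl)

theorem top_mul_arrSpan_pow (n : ℕ) : ⊤ * arrSpan k r ^ n = arrSpan k r ^ n * ⊤ := by
  induction n with
  | zero => rw [pow_zero, mul_one, one_mul]
  | succ n ih => rw [pow_succ, ← mul_assoc, ih, mul_assoc, top_mul_arrSpan, mul_assoc]

theorem arrSpan_mul_self_le : arrSpan k r * arrSpan k r ≤ Submodule.span k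
    {arr k r c₁ * arr k r d₁, arr k r d₁ * arr k r c₁, arr k r c₂ * arr k r d₂,
      arr k r d₂ * arr k r c₂, arr k r c₃ * arr k r d₃} := by
  rw [arrSpan_eq, Submodule.span_mul_span, Submodule.span_le]
  rintro _ ⟨_, ⟨a, b, f, rfl⟩, _, ⟨c, d, g, rfl⟩, rfl⟩
  cases f <;> cases g <;> first
    | (simp; done)
    | (apply Submodule.subset_span; simp; done)
    | (apply Submodule.subset_span; rw [c₁_mul_d₁]; exact Set.mem_insert _ _)

theorem arrSpan_pow_three_le : arrSpan k r ^ 3 ≤ Submodule.span k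
    {arr k r c₂ * arr k r d₂ * arr k r c₂, arr k r d₂ * arr k r c₂ * arr k r d₂} := by
  rw [pow_succ, pow_two]
  refine (mul_le_mul' (arrSpan_mul_self_le k r) le_rfl).trans ?_
  rw [arrSpan_eq, Submodule.span_mul_span, Submodule.span_le]
  rintro _ ⟨_, (rfl | rfl | rfl | rfl | rfl), _, ⟨c, d, g, rfl⟩, rfl⟩ <;> cases g <;> first
    | (simp [mul_assoc, c₁_mul_d₁_mul_c₁, d₁_mul_c₁_mul_d₁, c₃_mul_d₃_mul_c₃]; done)
    | (apply Submodule.subset_span; simp)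

/-- A nonzero path of odd length at least three alternates between `c₂` and `d₂`. -/
theorem arrSpan_pow_odd_le (m : ℕ) : arrSpan k r ^ (2 * (m + 1) + 1) ≤ Submodule.span k
    {(arr k r c₂ * arr k r d₂) ^ (m + 1) * arr k r c₂,
      (arr k r d₂ * arr k r c₂) ^ (m + 1) * arr k r d₂} := by
  induction m with
  | zero => simpa using arrSpan_pow_three_le k r
  | succ m ih =>
    have h : 2 * (m + 1 + 1) + 1 = 2 * (m + 1) + 1 + 1 + 1 := by ring
    rw [h, pow_succ _ (2 * (m + 1) + 1 + 1), pow_succ _ (2 * (m + 1) + 1)]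
    have h1 : arrSpan k r ^ (2 * (m + 1) + 1) * arrSpan k r ≤ Submodule.span k
        {(arr k r c₂ * arr k r d₂) ^ (m + 1 + 1), (arr k r d₂ * arr k r c₂) ^ (m + 1 + 1)} := by
      refine (mul_le_mul' ih le_rfl).trans ?_
      rw [arrSpan_eq, Submodule.span_mul_span, Submodule.span_le]
      rintro _ ⟨_, (rfl | rfl), _, ⟨c, d, g, rfl⟩, rfl⟩ <;> cases g <;> first
        | (simp [mul_assoc]; done)
        | (apply Submodule.subset_span; simp [pow_succ _ (m + 1), mul_assoc])
    refine (mul_le_mul' h1 le_rfl).trans ?_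
    rw [arrSpan_eq, Submodule.span_mul_span, Submodule.span_le]
    rintro _ ⟨_, (rfl | rfl), _, ⟨c, d, g, rfl⟩, rfl⟩ <;> cases g <;> first
      | (apply Submodule.subset_span; simp; done)
      | simp [pow_succ _ (m + 1), mul_assoc]

variable {r}

/-- The long paths `(c₂ d₂)^r c₂ = d₁ c₁ c₂` and `(d₂ c₂)^r d₂ = c₃ d₃ d₂` vanish, so all paths of
length `2 r + 1` do. -/
theorem arrSpan_pow_eq_bot (hr : 1 ≤ r) : arrSpan k r ^ (2 * r + 1) = ⊥ := by
  obtain ⟨m, rfl⟩ : ∃ m, r = m + 1 := ⟨r - 1, by omega⟩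
  refine eq_bot_iff.2 ((arrSpan_pow_odd_le k (m + 1) m).trans ?_)
  rw [Submodule.span_le]
  rintro _ (rfl | rfl)
  · rw [← d₁_mul_c₁, mul_assoc, c₁_mul_c₂, mul_zero]
    exact zero_mem _
  · rw [← c₃_mul_d₃, mul_assoc, d₃_mul_d₂, mul_zero]
    exact zero_mem _

/-- `B_r` is finite-dimensional: modulo `rad^n` it is spanned by finitely many paths. -/
theorem finite_algB (hr : 1 ≤ r) : Module.Finite k (AlgB k r) := by
  have hE : (vertSpan k r).FG := Submodule.fg_span (Set.finite_range _)
  have hG : (arrSpan k r).FG := Submodule.fg_span (Set.toFinite _)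
  have key : ∀ n, ∃ N : Submodule k (AlgB k r), N.FG ∧ N ⊔ ⊤ * arrSpan k r ^ n = ⊤ := by
    intro n
    induction n with
    | zero => exact ⟨⊥, Submodule.fg_bot, by rw [pow_zero, mul_one, bot_sup_eq]⟩
    | succ n ih =>
      obtain ⟨N, hN, h⟩ := ih
      refine ⟨vertSpan k r ⊔ N * arrSpan k r, hE.sup (hN.mul hG), ?_⟩
      have h2 := vertSpan_sup_top_mul k r
      rwa [← h, Submodule.sup_mul, h, ← sup_assoc, mul_assoc, ← pow_succ] at h2
  obtain ⟨N, hN, h⟩ := key (2 * r + 1)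
  rw [arrSpan_pow_eq_bot k hr, Submodule.mul_bot, sup_bot_eq] at h
  exact ⟨h ▸ hN⟩

theorem simple_hom_eq_zero (hr : 1 ≤ r) {x : AlgB k r} (hx : x ∈ ⊤ * arrSpan k r) :
    (simpleFamily (k := k) hr).hom x = 0 := by
  refine Submodule.mul_induction_on hx (fun a _ g hg => ?_) fun a b ha hb => ?_
  · rw [arrSpan_eq] at hg
    rw [map_mul]
    induction hg using Submodule.span_induction with
    | mem g hg =>
      obtain ⟨_, _, f, rfl⟩ := hg
      rw [Family.hom_arr]
      exact mul_zero _
    | zero => simp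
    | add g g' _ _ h h' => rw [map_add, mul_add, h, h', add_zero]
    | smul c g _ h => rw [map_smul, mul_smul_comm, h, smul_zero]
  · rw [map_add, ha, hb, add_zero]

theorem simple_hom_surjective (hr : 1 ≤ r) :
    Function.Surjective (simpleFamily (k := k) hr).hom := by
  intro v
  refine ⟨∑ a, v a • vert k r a, ?_⟩
  ext b
  simp [simpleFamily, Pi.single_apply]

theorem exists_eq_sum_vert_add (x : AlgB k r) :
    ∃ (v : BVertex → k) (y : AlgB k r), y ∈ ⊤ * arrSpan k r ∧ x = ∑ a, v a • vert k r a + y := by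
  have hx : x ∈ vertSpan k r ⊔ ⊤ * arrSpan k r :=
    (vertSpan_sup_top_mul k r).symm.le Submodule.mem_top
  obtain ⟨e, he, y, hy, rfl⟩ := Submodule.mem_sup.1 hx
  obtain ⟨v, rfl⟩ := (Submodule.mem_span_range_iff_exists_fun k).1 he
  exact ⟨v, y, hy, rfl⟩

theorem simple_hom_eq_zero_iff (hr : 1 ≤ r) {x : AlgB k r} :
    (simpleFamily (k := k) hr).hom x = 0 ↔ x ∈ ⊤ * arrSpan k r := by
  refine ⟨fun hx => ?_, simple_hom_eq_zero k hr⟩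
  obtain ⟨v, y, hy, rfl⟩ := exists_eq_sum_vert_add k x
  rw [map_add, simple_hom_eq_zero k hr hy, add_zero] at hx
  have hv : ∀ a, v a = 0 := fun a => by
    simpa [simpleFamily, Pi.single_apply] using congrFun hx a
  simpa [hv] using hy

theorem pow_mem_top_mul {x : AlgB k r} (hx : x ∈ ⊤ * arrSpan k r) (n : ℕ) :
    x ^ n ∈ ⊤ * arrSpan k r ^ n := by
  induction n with
  | zero => simp
  | succ n ih =>
    have := Submodule.mul_mem_mul ih hx
    rwa [top_mul_arrSpan, mul_assoc, ← mul_assoc _ _ (⊤ : Submodule k (AlgB k r)), ← pow_succ,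
      ← top_mul_arrSpan_pow, ← mul_assoc, top_mul_top, ← pow_succ] at this

theorem mem_ringJacobson_iff (hr : 1 ≤ r) {x : AlgB k r} :
    x ∈ Ring.jacobson (AlgB k r) ↔ x ∈ ⊤ * arrSpan k r := by
  rw [← simple_hom_eq_zero_iff k hr]
  constructor
  · exact RingHom.map_eq_zero_of_mem_jacobson (simpleFamily (k := k) hr).hom.toRingHom
      (simple_hom_surjective k hr)
  · intro hx
    refine Ideal.le_ringJacobson_of_isNilpotent (RingHom.ker (simpleFamily (k := k) hr).hom)
      (fun y hy => ⟨2 * r + 1, ?_⟩) hx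
    have := pow_mem_top_mul k ((simple_hom_eq_zero_iff k hr).1 hy) (2 * r + 1)
    rwa [arrSpan_pow_eq_bot k hr, Submodule.mul_bot, Submodule.mem_bot] at this

/-- The `n`-th power of the radical of `B_r` is spanned by the paths of length at least `n`. -/
theorem radPow_eq (hr : 1 ≤ r) (n : ℕ) : radPow k (AlgB k r) n = ⊤ * arrSpan k r ^ n := by
  have h1 : ∀ x, x ∈ radPow k (AlgB k r) 1 ↔ x ∈ ⊤ * arrSpan k r := fun x => by
    rw [← mem_ringJacobson_iff k hr, radPow, Submodule.restrictScalars_mem, Submodule.pow_one]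
  induction n with
  | zero => exact (eq_top_iff.2 fun x _ => RadLayer.mem_radPow_zero k x).trans (by simp)
  | succ n ih =>
    refine le_antisymm (fun x hx => ?_) ?_
    · change x ∈ Ring.jacobson (AlgB k r) ^ (n + 1) at hx
      rw [Ideal.IsTwoSided.pow_add, Submodule.pow_one] at hx
      refine Submodule.smul_induction_on hx (fun a ha b hb => ?_) fun a b => add_mem
      have ha' : a ∈ ⊤ * arrSpan k r ^ n := ih ▸ ha
      have := Submodule.mul_mem_mul ha' ((mem_ringJacobson_iff k hr).1 hb)
      rwa [top_mul_arrSpan, mul_assoc, ← mul_assoc _ _ (⊤ : Submodule k (AlgB k r)), ← pow_succ,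
        ← top_mul_arrSpan_pow, ← mul_assoc, top_mul_top] at this
    · rw [pow_succ, ← mul_assoc, ← ih, Submodule.mul_le]
      intro a ha g hg
      exact RadLayer.mul_mem_radPow k ha ((h1 g).2 (le_top_mul k r _ hg))

end AlgB

namespace AlgB

open BVertex BArrow

variable {k : Type*} [Field k] {r : ℕ}

/-! ### The right socle of `B_r` -/

theorem mul_eq_zero_of_mem_top_mul_sq {p : AlgB k r}
    (h : ∀ {a b c d : BVertex} (f : BArrow a b) (g : BArrow c d),
      arr k r f * (arr k r g * p) = 0)
    {y : AlgB k r} (hy : y ∈ ⊤ * arrSpan k r ^ 2) : y * p = 0 := by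
  have h2 : arrSpan k r ^ 2 ≤ LinearMap.ker (LinearMap.mulRight k p) := by
    rw [pow_two, arrSpan_eq, Submodule.span_mul_span, Submodule.span_le]
    rintro _ ⟨_, ⟨_, _, f, rfl⟩, _, ⟨_, _, g, rfl⟩, rfl⟩
    simpa [mul_assoc] using h f g
  refine Submodule.mul_induction_on hy (fun a _ b hb => ?_) fun a b ha hb => ?_
  · have : b * p = 0 := h2 hb
    rw [mul_assoc, this, mul_zero]
  · rw [add_mul, ha, hb, add_zero]

theorem dual_hom_eq_zero (hr : 1 ≤ r) {y : AlgB k r} (hy : y ∈ ⊤ * arrSpan k r ^ 2) :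
    (dualFamily (k := k) hr).hom y = 0 := by
  have h2 : arrSpan k r ^ 2 ≤ LinearMap.ker (dualFamily (k := k) hr).hom.toLinearMap := by
    rw [pow_two, arrSpan_eq, Submodule.span_mul_span, Submodule.span_le]
    rintro _ ⟨_, ⟨_, _, f, rfl⟩, _, ⟨_, _, g, rfl⟩, rfl⟩
    cases f <;> cases g <;> simp [dualFamily, matrixFamily, label]
  refine Submodule.mul_induction_on hy (fun a _ b hb => ?_) fun a b ha hb => ?_
  · have : (dualFamily (k := k) hr).hom b = 0 := h2 hb
    rw [map_mul, this, mul_zero]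
  · rw [map_add, ha, hb, add_zero]

theorem sum_bVertex {M : Type*} [AddCommMonoid M] (f : BVertex → M) :
    ∑ a, f a = f v1 + (f v2 + f v3) := by
  change ∑ a ∈ {v1, v2, v3}, f a = _
  simp

theorem exists_eq_sum (x : AlgB k r) :
    ∃ (v : BVertex → k) (b₁ b₂ b₃ b₄ b₅ b₆ : k) (y : AlgB k r), y ∈ ⊤ * arrSpan k r ^ 2 ∧
      x = ∑ a, v a • vert k r a + (b₁ • arr k r c₁ + (b₂ • arr k r c₂ + (b₃ • arr k r c₃ +
        (b₄ • arr k r d₁ + (b₅ • arr k r d₂ + b₆ • arr k r d₃))))) + y := by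
  obtain ⟨v, z, hz, rfl⟩ := exists_eq_sum_vert_add k x
  rw [← vertSpan_sup_top_mul, Submodule.sup_mul, mul_assoc, ← pow_two] at hz
  obtain ⟨g, hg, y, hy, rfl⟩ := Submodule.mem_sup.1 hz
  have hg := vertSpan_mul_arrSpan k r hg
  rw [arrSpan] at hg
  simp only [Submodule.mem_span_insert, Submodule.mem_span_singleton] at hg
  obtain ⟨b₁, _, ⟨b₂, _, ⟨b₃, _, ⟨b₄, _, ⟨b₅, _, ⟨b₆, rfl⟩, rfl⟩, rfl⟩, rfl⟩, rfl⟩, rfl⟩ := hg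
  exact ⟨v, b₁, b₂, b₃, b₄, b₅, b₆, y, hy, (add_assoc _ _ _).symm⟩

/-- An element of `B_r` annihilated on the right by the radical lies in the square of the radical:
`B_r` has no projective simple module, and every arrow can be prolonged to a nonzero element
of the socle. -/
theorem mem_of_forall_mul_eq_zero (hr : 1 ≤ r) {x : AlgB k r}
    (hx : ∀ y ∈ ⊤ * arrSpan k r, x * y = 0) : x ∈ ⊤ * arrSpan k r ^ 2 := by
  have harr : ∀ (t : AlgB k r) {a b : BVertex} (f : BArrow a b), x * (t * arr k r f) = 0 :=
    fun t _ _ f => hx _ (Submodule.mul_mem_mul Submodule.mem_top (arr_mem_arrSpan k r f))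
  have harr' : ∀ {a b : BVertex} (f : BArrow a b) (t : AlgB k r), x * (arr k r f * t) = 0 :=
    fun f t => by
      refine hx _ ?_
      rw [top_mul_arrSpan]
      exact Submodule.mul_mem_mul (arr_mem_arrSpan k r f) Submodule.mem_top
  obtain ⟨v, b₁, b₂, b₃, b₄, b₅, b₆, y, hy, rfl⟩ := exists_eq_sum x
  -- Modulo `rad^2`, the product of `x` with an arrow `f` from `a` is `v a • f`.
  have hv : ∀ {a b : BVertex} (f : BArrow a b), v a = 0 := by
    intro a b f
    have h := congrArg (fun z => ((dualFamily (k := k) hr).hom z a b).snd) (harr 1 f)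
    rw [one_mul] at h
    simp only [map_mul, map_add, dual_hom_eq_zero hr hy, sum_bVertex, map_smul, map_zero] at h
    cases f <;> simpa [dualFamily, matrixFamily, label] using h
  have hv1 := hv c₁
  have hv2 := hv c₂
  have hv3 := hv c₃
  obtain ⟨m, rfl⟩ : ∃ m, r = m + 1 := ⟨r - 1, by omega⟩
  simp only [sum_bVertex, hv1, hv2, hv3, zero_smul, add_zero, zero_add] at harr' ⊢
  have s₁ : arr k (m + 1) c₁ * arr k (m + 1) d₁ ≠ 0 := c₁_mul_d₁_ne_zero hr
  have s₂ : arr k (m + 1) d₁ * arr k (m + 1) c₁ ≠ 0 := d₁_mul_c₁_ne_zero hr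
  have s₃ : arr k (m + 1) c₃ * arr k (m + 1) d₃ ≠ 0 := c₃_mul_d₃_ne_zero hr
  have e₂ : arr k (m + 1) c₂ * (arr k (m + 1) d₂ * (arr k (m + 1) c₂ * arr k (m + 1) d₂) ^ m) =
      arr k (m + 1) d₁ * arr k (m + 1) c₁ := by
    rw [d₁_mul_c₁, pow_succ', mul_assoc]
  have e₃ : arr k (m + 1) d₂ * (arr k (m + 1) c₂ * (arr k (m + 1) d₂ * arr k (m + 1) c₂) ^ m) =
      arr k (m + 1) c₃ * arr k (m + 1) d₃ := by
    rw [c₃_mul_d₃, pow_succ', mul_assoc]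
  have hd₂ : ∀ {a b : BVertex} (f : BArrow a b), b ≠ v3 ∨ a = v1 → ∀ t,
      arr k (m + 1) f * (arr k (m + 1) d₂ * t) = 0 := by
    intro a b f h t
    rw [← mul_assoc]
    cases f <;> simp at h ⊢
  have hc₂ : ∀ {a b : BVertex} (f : BArrow a b), b ≠ v2 ∨ a = v1 → ∀ t,
      arr k (m + 1) f * (arr k (m + 1) c₂ * t) = 0 := by
    intro a b f h t
    rw [← mul_assoc]
    cases f <;> simp at h ⊢
  -- For each arrow `f`, multiply `x` by the path that prolongs `f` to an element of the socle. All
  -- other terms die, so the coefficient of `f` vanishes.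
  have z₁ : b₁ = 0 := by
    have hy0 : y * arr k (m + 1) d₁ = 0 := mul_eq_zero_of_mem_top_mul_sq (fun f g => by
      cases g <;> first
        | simp
        | (cases f <;> first | exact d₁_mul_c₁_mul_d₁ k _ | (rw [← mul_assoc]; simp))) hy
    simpa [add_mul, hy0, s₁] using harr' d₁ 1
  have z₄ : b₄ = 0 := by
    have hy0 : y * arr k (m + 1) c₁ = 0 := mul_eq_zero_of_mem_top_mul_sq (fun f g => by
      cases g <;> first
        | simp
        | (cases f <;> first | exact c₁_mul_d₁_mul_c₁ k _ | (rw [← mul_assoc]; simp))) hy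
    simpa [add_mul, hy0, s₂] using harr' c₁ 1
  have z₃ : b₃ = 0 := by
    have hy0 : y * arr k (m + 1) d₃ = 0 := mul_eq_zero_of_mem_top_mul_sq (fun f g => by
      cases g <;> first
        | simp
        | (cases f <;> first | exact d₃_mul_c₃_mul_d₃ k _ | (rw [← mul_assoc]; simp))) hy
    simpa [add_mul, hy0, s₃] using harr' d₃ 1
  have z₆ : b₆ = 0 := by
    have hy0 : y * arr k (m + 1) c₃ = 0 := mul_eq_zero_of_mem_top_mul_sq (fun f g => by
      cases g <;> first
        | simp
        | (cases f <;> first | exact c₃_mul_d₃_mul_c₃ k _ | (rw [← mul_assoc]; simp))) hy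
    have hs : arr k (m + 1) d₃ * arr k (m + 1) c₃ ≠ 0 := c₁_mul_d₁ k (m + 1) ▸ s₁
    simpa [add_mul, hy0, hs] using harr' c₃ 1
  have z₂ : b₂ = 0 := by
    have hy0 : y * (arr k (m + 1) d₂ * (arr k (m + 1) c₂ * arr k (m + 1) d₂) ^ m) = 0 :=
      mul_eq_zero_of_mem_top_mul_sq (fun f g => by
        cases g <;> first
          | simp [hd₂]
          | (rw [e₂]; cases f <;> first | exact c₁_mul_d₁_mul_c₁ k _ | (rw [← mul_assoc]; simp))) hy
    simpa [add_mul, hy0, hd₂, e₂, s₂] using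
      harr' d₂ ((arr k (m + 1) c₂ * arr k (m + 1) d₂) ^ m)
  have z₅ : b₅ = 0 := by
    have hy0 : y * (arr k (m + 1) c₂ * (arr k (m + 1) d₂ * arr k (m + 1) c₂) ^ m) = 0 :=
      mul_eq_zero_of_mem_top_mul_sq (fun f g => by
        cases g <;> first
          | simp [hc₂]
          | (rw [e₃]; cases f <;> first | exact d₃_mul_c₃_mul_d₃ k _ | (rw [← mul_assoc]; simp))) hy
    simpa [add_mul, hy0, hc₂, e₃, s₃] using
      harr' c₂ ((arr k (m + 1) d₂ * arr k (m + 1) c₂) ^ m)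
  simpa [z₁, z₂, z₃, z₄, z₅, z₆] using hy

end AlgB

/-! ### The graded algebra of the radical filtration -/

section RadGraded

open DirectSum

variable {k A : Type*} [Field k] [Ring A] [Algebra k A]

namespace RadGraded

theorem mem_of_mk_eq_zero {i : ℕ} {x : A} {hx : x ∈ radPow k A i}
    (h : RadLayer.mk k i x hx = 0) : x ∈ radPow k A (i + 1) := by
  have := (Submodule.Quotient.mk_eq_zero _).1 h
  exact this

/-- The linear map on a layer induced by an algebra homomorphism on `A` that kills the radical. It
is zero in positive degree. -/
noncomputable def layerMap {B : Type*} [Ring B] [Algebra k B] (χ : A →ₐ[k] B)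
    (h : ∀ x ∈ radPow k A 1, χ x = 0) (i : ℕ) : RadLayer k A i →ₗ[k] B :=
  Submodule.liftQ _ ((if i = 0 then χ.toLinearMap else 0).comp (radPow k A i).subtype)
    fun x hx => by
    rw [LinearMap.mem_ker]
    by_cases hi : i = 0
    · subst hi
      exact h x hx
    · simp [hi]

theorem layerMap_mk_zero {B : Type*} [Ring B] [Algebra k B] (χ : A →ₐ[k] B)
    (h : ∀ x ∈ radPow k A 1, χ x = 0) {x : A} (hx : x ∈ radPow k A 0) :
    layerMap χ h 0 (RadLayer.mk k 0 x hx) = χ x := rfl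

theorem layerMap_of_ne_zero {B : Type*} [Ring B] [Algebra k B] (χ : A →ₐ[k] B)
    (h : ∀ x ∈ radPow k A 1, χ x = 0) {i : ℕ} (hi : i ≠ 0) : layerMap χ h i = 0 := by
  refine LinearMap.ext fun a => ?_
  obtain ⟨x, hx, rfl⟩ := RadLayer.exists_mk k a
  change (if i = 0 then χ.toLinearMap else 0) x = 0
  rw [if_neg hi, LinearMap.zero_apply]

theorem layerMap_mul {B : Type*} [Ring B] [Algebra k B] (χ : A →ₐ[k] B)
    (h : ∀ x ∈ radPow k A 1, χ x = 0) {i j : ℕ} (a : RadLayer k A i) (b : RadLayer k A j) :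
    layerMap χ h (i + j) (RadLayer.mulHom k i j a b) = layerMap χ h i a * layerMap χ h j b := by
  by_cases hij : i = 0 ∧ j = 0
  · obtain ⟨rfl, rfl⟩ := hij
    obtain ⟨x, hx, rfl⟩ := RadLayer.exists_mk k a
    obtain ⟨y, hy, rfl⟩ := RadLayer.exists_mk k b
    exact map_mul χ x y
  · rw [layerMap_of_ne_zero χ h (by omega : i + j ≠ 0), LinearMap.zero_apply]
    by_cases hi : i = 0
    · rw [layerMap_of_ne_zero χ h (fun hj => hij ⟨hi, hj⟩ : j ≠ 0), LinearMap.zero_apply,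
        mul_zero]
    · rw [layerMap_of_ne_zero χ h hi, LinearMap.zero_apply, zero_mul]

/-- An algebra homomorphism on `A` that kills the radical factors through the projection
`gr A → A / rad A` to degree zero. -/
noncomputable def degreeZeroHom {B : Type*} [Ring B] [Algebra k B] (χ : A →ₐ[k] B)
    (h : ∀ x ∈ radPow k A 1, χ x = 0) : RadGraded k A →ₐ[k] B :=
  DirectSum.toAlgebra k (RadLayer k A) (layerMap χ h) (map_one χ) (layerMap_mul χ h)

theorem degreeZeroHom_of {B : Type*} [Ring B] [Algebra k B] (χ : A →ₐ[k] B)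
    (h : ∀ x ∈ radPow k A 1, χ x = 0) (i : ℕ) (a : RadLayer k A i) :
    degreeZeroHom χ h (of (RadLayer k A) i a) = layerMap χ h i a :=
  toModule_lof k (M := RadLayer k A) i a

theorem degreeZeroHom_apply {B : Type*} [Ring B] [Algebra k B] (χ : A →ₐ[k] B)
    (h : ∀ x ∈ radPow k A 1, χ x = 0) (u : RadGraded k A) :
    degreeZeroHom χ h u = layerMap χ h 0 (u 0) := by
  induction u using DirectSum.induction_on with
  | zero => rw [map_zero, DirectSum.zero_apply, map_zero]
  | of i a =>
    rw [degreeZeroHom_of]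
    by_cases hi : i = 0
    · subst hi
      rw [of_eq_same]
    · rw [of_eq_of_ne _ _ _ (Ne.symm hi), layerMap_of_ne_zero _ _ hi, map_zero,
        LinearMap.zero_apply]
  | add u v hu hv => rw [map_add, hu, hv, DirectSum.add_apply, map_add]

theorem degreeZeroHom_surjective {B : Type*} [Ring B] [Algebra k B] (χ : A →ₐ[k] B)
    (h : ∀ x ∈ radPow k A 1, χ x = 0) (hχ : Function.Surjective χ) :
    Function.Surjective (degreeZeroHom χ h) := fun b => by
  obtain ⟨x, rfl⟩ := hχ b
  refine ⟨of (RadLayer k A) 0 (RadLayer.mk k 0 x (RadLayer.mem_radPow_zero k x)), ?_⟩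
  rw [degreeZeroHom_of]
  rfl

theorem apply_zero_eq_zero_of_degreeZeroHom {B : Type*} [Ring B] [Algebra k B] (χ : A →ₐ[k] B)
    (h : ∀ x ∈ radPow k A 1, χ x = 0) (h' : ∀ x, χ x = 0 → x ∈ radPow k A 1) {u : RadGraded k A}
    (hu : degreeZeroHom χ h u = 0) : u 0 = 0 := by
  rw [degreeZeroHom_apply] at hu
  obtain ⟨x, hx, hx'⟩ := RadLayer.exists_mk k (u 0)
  rw [hx', layerMap_mk_zero] at hu
  rw [hx']
  exact RadLayer.mk_eq_zero k hx (h' x hu)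

/-- A product of two elements of positive degree has no term of degree one. -/
theorem mul_apply_one_eq_zero {u v : RadGraded k A} (hu : u 0 = 0) (hv : v 0 = 0) :
    (u * v) 1 = 0 := by
  classical
  rw [mul_eq_sum_support_ghas_mul, DFinsupp.finsetSum_apply]
  refine Finset.sum_eq_zero fun ij hij => ?_
  rw [Finset.mem_product, DFinsupp.mem_support_iff, DFinsupp.mem_support_iff] at hij
  have h1 : ij.1 ≠ 0 := fun h => hij.1 (h ▸ hu)
  have h2 : ij.2 ≠ 0 := fun h => hij.2 (h ▸ hv)
  exact of_eq_of_ne _ _ _ (by omega)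

/-- If `x` multiplies `rad^i A` into `rad^(i+2) A` for all `i ≥ 1`, then its class in degree one of
the graded algebra is annihilated by the elements of positive degree. -/
theorem of_one_mul_eq_zero {x : A} (hx : x ∈ radPow k A 1)
    (h : ∀ i, ∀ y ∈ radPow k A (i + 1), x * y ∈ radPow k A (1 + (i + 1) + 1))
    {v : RadGraded k A} (hv : v 0 = 0) :
    of (RadLayer k A) 1 (RadLayer.mk k 1 x hx) * v = 0 := by
  classical
  rw [mul_eq_sum_support_ghas_mul]
  refine Finset.sum_eq_zero fun ij hij => ?_
  rw [Finset.mem_product, DFinsupp.mem_support_iff, DFinsupp.mem_support_iff] at hij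
  obtain ⟨i, j⟩ := ij
  have h2 : j ≠ 0 := fun h => hij.2 (h ▸ hv)
  have h1 : i = 1 := by
    by_contra h
    exact hij.1 (of_eq_of_ne _ _ _ h)
  subst h1
  obtain ⟨j, rfl⟩ := Nat.exists_eq_succ_of_ne_zero h2
  obtain ⟨y, hy, hy'⟩ := RadLayer.exists_mk k (v (j + 1))
  dsimp only
  rw [of_eq_same]
  have : GradedMonoid.GMul.mul (RadLayer.mk k 1 x hx) (v (j + 1)) = 0 := by
    rw [hy']
    exact RadLayer.mk_eq_zero k _ (h j y hy)
  exact (congrArg _ this).trans (map_zero _)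

end RadGraded

end RadGraded

/-! ### `B_r` is not tightly graded for `r ≥ 2` -/

namespace AlgB

open BVertex BArrow DirectSum

variable {k : Type*} [Field k] {r : ℕ}

theorem top_mul_arrSpan_pow_antitone {m n : ℕ} (h : m ≤ n) :
    ⊤ * arrSpan k r ^ n ≤ ⊤ * arrSpan k r ^ m := by
  obtain ⟨l, rfl⟩ := Nat.exists_eq_add_of_le h
  rw [add_comm, pow_add, ← mul_assoc]
  exact mul_le_mul' le_top le_rfl

/-- For `r ≥ 2` the relation `d₁ c₁ = (c₂ d₂) ^ r` pushes `d₁ * rad^i` into `rad^(i+2)`. -/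
theorem d₁_mul_mem (hr : 2 ≤ r) (i : ℕ) {y : AlgB k r} (hy : y ∈ ⊤ * arrSpan k r ^ (i + 1)) :
    arr k r d₁ * y ∈ ⊤ * arrSpan k r ^ (1 + (i + 1) + 1) := by
  have hcd : ∀ n, (arr k r c₂ * arr k r d₂) ^ n ∈ arrSpan k r ^ (2 * n) := fun n => by
    rw [pow_mul, pow_two]
    exact Submodule.pow_mem_pow _
      (Submodule.mul_mem_mul (arr_mem_arrSpan k r c₂) (arr_mem_arrSpan k r d₂)) n
  have h1 : arrSpan k r ≤ (⊤ * arrSpan k r ^ 3).comap (LinearMap.mulLeft k (arr k r d₁)) := by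
    conv_lhs => rw [arrSpan_eq]
    rw [Submodule.span_le]
    rintro _ ⟨_, _, f, rfl⟩
    cases f <;> simp [d₁_mul_c₁]
    exact top_mul_arrSpan_pow_antitone (by omega) (le_top_mul k r _ (hcd r))
  rw [top_mul_arrSpan_pow, pow_succ', mul_assoc] at hy
  refine Submodule.mul_induction_on hy (fun a ha b hb => ?_) fun a b ha hb => ?_
  · have ha' : arr k r d₁ * a ∈ ⊤ * arrSpan k r ^ 3 := h1 ha
    have := Submodule.mul_mem_mul ha' hb
    rwa [mul_assoc, ← mul_assoc (arrSpan k r ^ 3), ← pow_add, ← top_mul_arrSpan_pow, ← mul_assoc,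
      top_mul_top,
      show 3 + i = 1 + (i + 1) + 1 by ring, mul_assoc (arr k r d₁)] at this
  · rw [mul_add]
    exact add_mem ha hb

theorem d₁_notMem (hr : 1 ≤ r) : arr k r d₁ ∉ ⊤ * arrSpan k r ^ 2 := fun h => by
  have := congrArg (fun M => (M v2 v1).snd) (dual_hom_eq_zero hr h)
  simp [dualFamily, matrixFamily, label] at this

/-- For `r ≥ 2` the class of `d₁` in the graded algebra of `B_r` is annihilated on the right by the
radical without being in the square of the radical; there is no such element in `B_r`. -/
theorem not_isTightlyGraded (hr : 2 ≤ r) : ¬ IsTightlyGraded k (AlgB k r) := by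
  rintro ⟨φ⟩
  have hr1 : 1 ≤ r := by omega
  have hχ : ∀ x ∈ radPow k (AlgB k r) 1, (simpleFamily (k := k) hr1).hom x = 0 := fun x hx => by
    rw [radPow_eq k hr1, pow_one] at hx
    exact simple_hom_eq_zero k hr1 hx
  have hχ' : ∀ x, (simpleFamily (k := k) hr1).hom x = 0 →
      x ∈ radPow k (AlgB k r) 1 := fun x hx => by
    rw [radPow_eq k hr1, pow_one]
    exact (simple_hom_eq_zero_iff k hr1).1 hx
  -- The composite of `φ` with the projection to degree zero maps onto a semisimple algebra, so it
  -- kills the radical; the radical of the graded algebra itself need not be known.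
  have hφ : ∀ y ∈ ⊤ * arrSpan k r, φ y 0 = 0 := fun y hy =>
    RadGraded.apply_zero_eq_zero_of_degreeZeroHom (simpleFamily (k := k) hr1).hom hχ hχ'
      (RingHom.map_eq_zero_of_mem_jacobson
        ((RadGraded.degreeZeroHom (simpleFamily (k := k) hr1).hom hχ).comp φ.toAlgHom).toRingHom
        ((RadGraded.degreeZeroHom_surjective _ hχ (simple_hom_surjective k hr1)).comp φ.surjective)
        ((mem_ringJacobson_iff k hr1).2 hy))
  have hd : arr k r d₁ ∈ radPow k (AlgB k r) 1 := by
    rw [radPow_eq k hr1, pow_one]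
    exact le_top_mul k r _ (arr_mem_arrSpan k r d₁)
  obtain ⟨x, hx⟩ := φ.surjective (of (RadLayer k (AlgB k r)) 1 (RadLayer.mk k 1 _ hd))
  have hx0 : ∀ y ∈ ⊤ * arrSpan k r, x * y = 0 := fun y hy => by
    rw [← map_eq_zero_iff φ φ.injective, map_mul, hx]
    refine RadGraded.of_one_mul_eq_zero hd (fun i z hz => ?_) (hφ y hy)
    rw [radPow_eq k hr1] at hz ⊢
    exact d₁_mul_mem hr i hz
  have hx2 := mem_of_forall_mul_eq_zero hr1 hx0
  have hx1 : φ x 1 = 0 := by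
    rw [pow_two, ← mul_assoc] at hx2
    refine Submodule.mul_induction_on hx2 (fun a ha b hb => ?_) fun a b ha hb => ?_
    · rw [map_mul]
      exact RadGraded.mul_apply_one_eq_zero (hφ a ha) (hφ b (le_top_mul k r _ hb))
    · rw [map_add, DirectSum.add_apply, ha, hb, add_zero]
  rw [hx, of_eq_same] at hx1
  have : arr k r d₁ ∈ radPow k (AlgB k r) 2 := RadGraded.mem_of_mk_eq_zero hx1
  rw [radPow_eq k hr1] at this
  exact d₁_notMem hr1 this

end AlgB

namespace AlgB

open BVertex BArrow DirectSum

variable (k : Type*) [Field k]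

/-! ### The path length grading of `B_1` -/

/-- The span of the paths of length `n` in `B_1`. -/
noncomputable def lengthSpan (n : ℕ) : Submodule k (AlgB k 1) :=
  Submodule.span k {x | ∃ (a b : BVertex) (p : Quiver.Path a b), p.length = n ∧ x = path k 1 p}

theorem path_mem_lengthSpan {a b : BVertex} (p : Quiver.Path a b) :
    path k 1 p ∈ lengthSpan k p.length :=
  Submodule.subset_span ⟨a, b, p, rfl, rfl⟩

theorem vert_mem_lengthSpan (a : BVertex) : vert k 1 a ∈ lengthSpan k 0 :=
  path_mem_lengthSpan k (Quiver.Path.nil : Quiver.Path a a)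

theorem arr_mem_lengthSpan {a b : BVertex} (f : BArrow a b) : arr k 1 f ∈ lengthSpan k 1 :=
  path_mem_lengthSpan k (Quiver.Hom.toPath (show a ⟶ b from f))

instance : SetLike.GradedMonoid (lengthSpan k) where
  one_mem := by
    rw [← sum_vert]
    exact sum_mem fun a _ => vert_mem_lengthSpan k a
  mul_mem i j x y hx hy := by
    have h : lengthSpan k i * lengthSpan k j ≤ lengthSpan k (i + j) := by
      rw [lengthSpan, lengthSpan, Submodule.span_mul_span, Submodule.span_le]
      rintro _ ⟨_, ⟨a, b, p, rfl, rfl⟩, _, ⟨c, d, q, rfl, rfl⟩, rfl⟩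
      by_cases h : b = c
      · subst h
        dsimp only
        rw [path_mul_path, ← Quiver.Path.length_comp]
        exact path_mem_lengthSpan k _
      · dsimp only
        rw [path_mul_path_of_ne _ _ _ _ h]
        exact zero_mem _
    exact h (Submodule.mul_mem_mul hx hy)

variable {k} in
/-- An element of degree `n`, as a homogeneous element of the external direct sum. -/
noncomputable def homog (n : ℕ) (x : AlgB k 1) (hx : x ∈ lengthSpan k n) : ⨁ i, lengthSpan k i :=
  of (fun i => lengthSpan k i) n ⟨x, hx⟩

variable {k}

theorem homog_congr {n m : ℕ} {x y : AlgB k 1} (hx : x ∈ lengthSpan k n) (hy : y ∈ lengthSpan k m)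
    (hnm : n = m) (hxy : x = y) : homog n x hx = homog m y hy := by
  subst hnm hxy
  rfl

theorem homog_mul_homog {n m : ℕ} {x y : AlgB k 1} (hx : x ∈ lengthSpan k n)
    (hy : y ∈ lengthSpan k m) :
    homog n x hx * homog m y hy = homog (n + m) (x * y) (SetLike.mul_mem_graded hx hy) :=
  of_mul_of _ _

theorem homog_zero (n : ℕ) : homog n (0 : AlgB k 1) (zero_mem _) = 0 :=
  map_zero (of (fun i => lengthSpan k i) n)

theorem homog_mul_eq_homog {n m l : ℕ} {x y z : AlgB k 1} (hx : x ∈ lengthSpan k n)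
    (hy : y ∈ lengthSpan k m) (hz : z ∈ lengthSpan k l) (h : n + m = l) (hxy : x * y = z) :
    homog n x hx * homog m y hy = homog l z hz :=
  (homog_mul_homog hx hy).trans (homog_congr _ _ h hxy)

theorem homog_mul_eq_zero {n m : ℕ} {x y : AlgB k 1} (hx : x ∈ lengthSpan k n)
    (hy : y ∈ lengthSpan k m) (hxy : x * y = 0) : homog n x hx * homog m y hy = 0 :=
  (homog_mul_eq_homog hx hy (zero_mem _) rfl hxy).trans (homog_zero _)

theorem homog_mul_eq_homog_mul {x y z w : AlgB k 1} (hx : x ∈ lengthSpan k 1)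
    (hy : y ∈ lengthSpan k 1) (hz : z ∈ lengthSpan k 1) (hw : w ∈ lengthSpan k 1)
    (h : x * y = z * w) : homog 1 x hx * homog 1 y hy = homog 1 z hz * homog 1 w hw :=
  (homog_mul_homog hx hy).trans ((homog_congr _ _ rfl h).trans (homog_mul_homog hz hw).symm)

variable (k)

/-- Vertices in degree zero and arrows in degree one satisfy the relations of `B_1`, since these are
homogeneous of degree two. -/
noncomputable def gradedFamily : Family k 1 (⨁ i, lengthSpan k i) where
  e a := homog 0 (vert k 1 a) (vert_mem_lengthSpan k a)
  g f := homog 1 (arr k 1 f) (arr_mem_lengthSpan k f)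
  e_mul_e a := homog_mul_eq_homog _ _ _ rfl (vert_mul_vert k 1 a)
  e_mul_e_of_ne a b h := homog_mul_eq_zero _ _ (vert_mul_vert_of_ne k 1 h)
  sum_e := by
    simp only [homog]
    rw [← map_sum]
    refine congrArg (of (fun i => lengthSpan k i) 0) (Subtype.ext ?_)
    rw [AddSubmonoidClass.coe_finsetSum]
    exact sum_vert k 1
  e_mul_g f := homog_mul_eq_homog _ _ _ rfl (vert_mul_arr k 1 f)
  g_mul_e f := homog_mul_eq_homog _ _ _ rfl (arr_mul_vert k 1 f)
  c₁c₂ := homog_mul_eq_zero _ _ (c₁_mul_c₂ k 1)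
  c₂c₃ := homog_mul_eq_zero _ _ (c₂_mul_c₃ k 1)
  c₃c₁ := homog_mul_eq_zero _ _ (c₃_mul_c₁ k 1)
  d₁d₃ := homog_mul_eq_zero _ _ (d₁_mul_d₃ k 1)
  d₃d₂ := homog_mul_eq_zero _ _ (d₃_mul_d₂ k 1)
  d₂d₁ := homog_mul_eq_zero _ _ (d₂_mul_d₁ k 1)
  c₁d₁ := homog_mul_eq_homog_mul _ _ _ _ (c₁_mul_d₁ k 1)
  d₁c₁ := by
    rw [pow_one]
    exact homog_mul_eq_homog_mul _ _ _ _ (by rw [d₁_mul_c₁, pow_one])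
  c₃d₃ := by
    rw [pow_one]
    exact homog_mul_eq_homog_mul _ _ _ _ (by rw [c₃_mul_d₃, pow_one])

theorem gradedFamily_hom_path {a b : BVertex} (p : Quiver.Path a b) :
    (gradedFamily k).hom (path k 1 p) = homog p.length (path k 1 p) (path_mem_lengthSpan k p) := by
  induction p with
  | nil => exact (gradedFamily k).hom_vert a
  | cons p f ih =>
    have h := congrArg (gradedFamily k).hom (path_cons k 1 p f)
    rw [map_mul, ih, (gradedFamily k).hom_arr] at h
    exact h.trans (homog_mul_eq_homog _ _ _ rfl (path_cons k 1 p f).symm)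

theorem gradedFamily_hom_coe (n : ℕ) (x : lengthSpan k n) :
    (gradedFamily k).hom (x : AlgB k 1) = of (fun i => lengthSpan k i) n x := by
  obtain ⟨x, hx⟩ := x
  change (gradedFamily k).hom x = homog n x hx
  induction hx using Submodule.span_induction with
  | mem x hx =>
    obtain ⟨a, b, p, rfl, rfl⟩ := hx
    exact gradedFamily_hom_path k p
  | zero => exact (map_zero _).trans (homog_zero n).symm
  | add x y hx hy h h' =>
    rw [map_add, h, h']
    exact (map_add (of (fun i => lengthSpan k i) n) ⟨x, hx⟩ ⟨y, hy⟩).symm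
  | smul c x hx h =>
    rw [map_smul, h]
    exact ((lof k ℕ (fun i => lengthSpan k i) n).map_smul c ⟨x, hx⟩).symm

theorem eq_top_of_forall_path_mem {N : Submodule k (AlgB k 1)}
    (h : ∀ {a b : BVertex} (p : Quiver.Path a b), path k 1 p ∈ N) : N = ⊤ :=
  eq_top_of_path (fun _ => h _) fun a b c p f _ => by
    have := h (p.cons (show b ⟶ c from f))
    rwa [path_cons] at this

/-- The grading of `B_1` by path length. -/
noncomputable instance : GradedAlgebra (lengthSpan k) :=
  GradedAlgebra.ofAlgHom (lengthSpan k) (gradedFamily k).hom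
    (AlgHom.ext fun x => by
      have h : LinearMap.eqLocus ((coeAlgHom (lengthSpan k)).comp (gradedFamily k).hom).toLinearMap
          (LinearMap.id : AlgB k 1 →ₗ[k] AlgB k 1) = ⊤ :=
        eq_top_of_forall_path_mem k fun p =>
          (congrArg (coeAlgHom (lengthSpan k)) (gradedFamily_hom_path k p)).trans
            (coeAlgHom_of (lengthSpan k) _ _)
      exact (Submodule.eq_top_iff'.1 h) x)
    (gradedFamily_hom_coe k)

/-- The degree zero part of `B_1` is the product of three copies of the field. -/
theorem isSemisimpleRing_lengthSpan_zero : IsSemisimpleRing (lengthSpan k 0) := by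
  let f : lengthSpan k 0 →+* (BVertex → k) :=
    { toFun := fun x => (simpleFamily (k := k) le_rfl).hom (x : AlgB k 1)
      map_one' := map_one (simpleFamily (k := k) le_rfl).hom
      map_mul' := fun x y => map_mul (simpleFamily (k := k) le_rfl).hom _ _
      map_zero' := map_zero (simpleFamily (k := k) le_rfl).hom
      map_add' := fun x y => map_add (simpleFamily (k := k) le_rfl).hom _ _ }
  have hf : Function.Bijective f := by
    constructor
    · rw [injective_iff_map_eq_zero]
      rintro ⟨x, hx⟩ h
      have hle : lengthSpan k 0 ≤ Submodule.span k (Set.range (vert k 1)) := by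
        refine Submodule.span_le.2 ?_
        rintro _ ⟨a, b, p, hp, rfl⟩
        cases p with
        | nil => exact Submodule.subset_span ⟨a, rfl⟩
        | cons p f => exact absurd hp (Nat.succ_ne_zero _)
      obtain ⟨v, rfl⟩ := (Submodule.mem_span_range_iff_exists_fun k).1 (hle hx)
      have h' : (simpleFamily (k := k) le_rfl).hom (∑ a, v a • vert k 1 a) = 0 := h
      have hv : ∀ a, v a = 0 := fun a => by
        simpa [simpleFamily, Pi.single_apply] using congrFun h' a
      exact Subtype.ext (by simp [hv])
    · intro v
      refine ⟨⟨∑ a, v a • vert k 1 a,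
        sum_mem fun a _ => Submodule.smul_mem _ _ (vert_mem_lengthSpan k a)⟩, ?_⟩
      change (simpleFamily (k := k) le_rfl).hom (∑ a, v a • vert k 1 a) = v
      ext b
      simp [simpleFamily, Pi.single_apply]
  exact (RingEquiv.ofBijective f hf).symm.isSemisimpleRing

theorem isTightGrading_lengthSpan : IsTightGrading k (lengthSpan k) := by
  refine ⟨isSemisimpleRing_lengthSpan_zero k, ?_⟩
  rw [← Algebra.toSubmodule_eq_top]
  refine eq_top_of_path (fun a => ?_) fun _ _ _ p f hp => ?_
  · exact Algebra.subset_adjoin (Or.inl (vert_mem_lengthSpan k a))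
  · exact mul_mem (S := Subalgebra k (AlgB k 1)) hp
      (Algebra.subset_adjoin (Or.inr (arr_mem_lengthSpan k f)))

end AlgB

/-! ### The characterization of `r = 1` -/

theorem mainTheorem10 (k : Type*) [Field k] [IsAlgClosed k] [CharP k 2] (r : ℕ) (hr : 1 ≤ r) :
    (IsTightlyGraded k (AlgB k r) ↔ r = 1) ∧ (HasTightGrading k (AlgB k r) ↔ r = 1) := by
  have := AlgB.finite_algB k hr
  have h1 : HasTightGrading k (AlgB k r) → IsTightlyGraded k (AlgB k r) :=
    fun ⟨𝒜, _, h⟩ => isTightlyGraded_of_isTightGrading 𝒜 h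
  have h2 : IsTightlyGraded k (AlgB k r) → r = 1 := fun h => by
    by_contra hne
    exact AlgB.not_isTightlyGraded (by omega) h
  have h3 : r = 1 → HasTightGrading k (AlgB k r) := by
    rintro rfl
    exact ⟨AlgB.lengthSpan k, inferInstance, AlgB.isTightGrading_lengthSpan k⟩
  exact ⟨⟨h2, fun h => h1 (h3 h)⟩, ⟨fun h => h2 (h1 h), h3⟩⟩
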